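/- **Conventions.** Let $\mathbb N=\{1,2,\dots\}$, let all spaces be real or complex (with one common scalar field), and write $[x_i]$ for the closed linear span of a sequence, and $E<F$ if $\max E<\min F$. For every countable limit ordinal $\lambda$ fix ordinals $\lambda_1\le\lambda_2\le\dots<\lambda$ with $\sup_n\lambda_n=\lambda$. The Schreier families are $\mathcal S_0=\{\{k\}:k\in\mathbb N\}\cup\{\emptyset\}$, $\mathcal S_{\beta+1}=\{F_1\cup\dots\cup F_k: k\le F_1<\dots<F_k,\ F_j\in\mathcal S_\beta\}$, and $\mathcal S_\lambda=\{F: n\le F\in\mathcal S_{\lambda_n}\text{ for some }n\}$ for limit $\lambda<\omega_1$. A family $\mathcal F$ of finite subsets of $\mathbb N$ is regular if it is hereditary, spreading (if $\{n_1<\dots<n_k\}\in\mathcal F$ and $m_1<\dots<m_k$, $n_i\le m_i$ for all $i$, then $\{m_1,\dots,m_k\}\in\mathcal F$) and compact in $2^{\mathbb N}$; $CB(\mathcal F)$ is its Cantor–Bendixson index, the least ordinal $\gamma$ such that the $\gamma$-th iterated derived set of $\mathcal F$ is empty. A sequence is basic if it is a Schauder basis of its closed linear span, and seminormalized if its norms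 are bounded above and bounded away from $0$. A sequence $(x_i)$ $C$-dominates $(y_i)$ if $\|\sum_i a_iy_i\|\le C\|\sum_i a_ix_i\|$ for all finitely supported scalars $(a_i)$, and dominates it if this holds for some $C\ge1$. A basic sequence $(x_i)$ is $\mathcal S_\alpha$-unconditional if for some $C\ge 1$, $\|\sum_{i\in F}a_ix_i\|\le C\|\sum_i a_ix_i\|$ for all finitely supported $(a_i)$ and all $F\in\mathcal S_\alpha$. Let $\alpha<\omega_1$ be a limit ordinal. A seminormalized basic sequence $(y_i)$ *$\alpha$-strongly dominates* a seminormalized basic sequence $(x_i)$ if $(y_i)$ is $\mathcal S_\alpha$-unconditional, $[y_i]$ contains no subspace isomorphic to $c_0$, and there are regular families $\mathcal F_1\subset\mathcal F_2\subset\dots$ with $\sup_nCB(\mathcal F_n)=\omega^\alpha$ such that $\Delta_n\to0$, where $$\Delta_n=\sup\Big\{\Big\|\sum_ia_ix_i\Big\|:\ (a_i)\text{ finitely supported},\ \max_{F\in\mathcal F_n}\Big\|\sum_{i\in F}a_iy_i\Big\|\le 2^{-n},\ \Big\|\sum_ia_iy_i\Big\|\le1\Big\}.$$ **Theorem.** Let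 $\alpha<\omega_1$ be a limit ordinal and let $X$ be a Banach space with an $\mathcal S_\alpha$-unconditional Schauder basis (supports and block sequences in $X$ are taken with respect to it). Let $E$ be a Banach space with an unconditional basis $(e_i)$ that is dominated by each of its subsequences, and assume that $E$ does not contain $c_0^n$'s uniformly, i.e. there is no constant $K$ such that for every $n$ the space $E$ has a subspace $K$-isomorphic to $\ell_\infty^n$. Assume that 1. there is a normalized basic sequence $(x_i)$ in $X$ that is $\alpha$-strongly dominated by $(e_i)$; 2. there is a constant $C\ge1$ such that for every $\beta<\alpha$ there are $r_\beta\in\mathbb N\cup\{0\}$ and a normalized block sequence $(x_i^\beta)_i$ in $X$ with $\operatorname{supp}x_i^\beta\in\mathcal S_{r_\beta}$ for all $i$, such that $\|\sum_{i\in F}a_ie_i\|\le C\|\sum_{i\in F}a_ix_i^\beta\|$ for all $F\in\mathcal S_\beta$ and all scalars $(a_i)_{i\in F}$. Then there are a closed subspace $Y\subset X$ and a bounded linear operator $T:Y\to X$ that is not compact and is strictly singular, i.e. the restriction of $T$ to any infinite-dimensional subspace of $Y$ is not an isomorphism onto its image. -/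

import Mathlib

open scoped Ordinal ENNReal ZeroAtInfty
open Set Filter Topology

noncomputable section

/-! Sequences are indexed by `ℕ = {0, 1, 2, …}`; the index `i` plays the role of the positive
integer `i + 1`. So "`k ≤ F`" (`k` at most every element of `F`) reads `k ≤ i + 1` for all `i ∈ F`.
-/

namespace SchreierOp

/-! ### Families of finite sets of integers -/

/-- A choice of approximating sequences: for every countable limit ordinal `o`, the sequence
`c o 0 ≤ c o 1 ≤ …` consists of ordinals below `o` and has supremum `o`. -/
def IsApproximating (c : Ordinal.{0} → ℕ → Ordinal.{0}) : Prop :=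
  ∀ o, Order.IsSuccLimit o → o < ω₁ →
    Monotone (c o) ∧ (∀ n, c o n < o) ∧ IsLUB (range (c o)) o

/-- The family of the unions `F₁ ∪ … ∪ F_k` with `k ≤ F₁ < … < F_k` and all `F_j` in `𝓕`. -/
def schreierSucc (𝓕 : Set (Finset ℕ)) : Set (Finset ℕ) :=
  {F | ∃ (k : ℕ) (G : Fin k → Finset ℕ),
    (∀ j, G j ∈ 𝓕) ∧
    (∀ j, ∀ i ∈ G j, k ≤ i + 1) ∧
    (∀ j j', j < j' → ∀ i ∈ G j, ∀ i' ∈ G j', i < i') ∧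
    F = Finset.univ.biUnion G}

/-- The Schreier family `S_o` built with the approximating sequences `c`. At a limit ordinal `o`,
the `(n + 1)`-st approximating ordinal is `c o n`, and the condition `n + 1 ≤ F` reads `n ≤ i` for
all `i ∈ F`. -/
def schreier (c : Ordinal.{0} → ℕ → Ordinal.{0}) (o : Ordinal.{0}) : Set (Finset ℕ) :=
  Ordinal.limitRecOn (motive := fun _ => Set (Finset ℕ)) o
    {F | F.card ≤ 1}
    (fun _ 𝓕 => schreierSucc 𝓕)
    (fun o _ S => {F | ∃ (n : ℕ) (h : c o n < o), F ∈ S (c o n) h ∧ ∀ i ∈ F, n ≤ i})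

theorem schreier_zero (c : Ordinal.{0} → ℕ → Ordinal.{0}) :
    schreier c 0 = {F | F.card ≤ 1} := by
  simp [schreier]

theorem schreier_add_one (c : Ordinal.{0} → ℕ → Ordinal.{0}) (o : Ordinal.{0}) :
    schreier c (o + 1) = schreierSucc (schreier c o) := by
  simp [schreier]

theorem schreier_limit (c : Ordinal.{0} → ℕ → Ordinal.{0}) (o : Ordinal.{0})
    (ho : Order.IsSuccLimit o) :
    schreier c o = {F | ∃ n : ℕ, c o n < o ∧ F ∈ schreier c (c o n) ∧ ∀ i ∈ F, n ≤ i} := by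
  ext F
  rw [schreier, Ordinal.limitRecOn_limit (h := ho)]
  simp only [mem_ofPred_eq, exists_prop]
  rfl

/-- The family `𝓕` as a subset of the Cantor space `2^ℕ`. -/
def toCantor (𝓕 : Set (Finset ℕ)) : Set (ℕ → Bool) :=
  (fun (F : Finset ℕ) (i : ℕ) => decide (i ∈ F)) '' 𝓕

/-- Regular families: hereditary, spreading and compact. -/
structure IsRegular (𝓕 : Set (Finset ℕ)) : Prop where
  hereditary : ∀ F ∈ 𝓕, ∀ G, G ⊆ F → G ∈ 𝓕
  spreading : ∀ (k : ℕ) (n m : Fin k → ℕ), StrictMono n → StrictMono m → (∀ j, n j ≤ m j) →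
    Finset.univ.image n ∈ 𝓕 → Finset.univ.image m ∈ 𝓕
  compact : IsCompact (toCantor 𝓕)

/-- The Cantor–Bendixson index: the least `o` such that the `o`-th derivative of `𝓕` is empty. -/
def cbIndex (𝓕 : Set (Finset ℕ)) : Ordinal.{0} :=
  sInf {o | CantorBendixson.iteratedDerivedSet (toCantor 𝓕) o = ∅}

/-! ### Sequences in normed spaces -/

section Sequences

variable (𝕜 : Type*) [RCLike 𝕜]
variable {X : Type*} [NormedAddCommGroup X] [NormedSpace 𝕜 X]
variable {Y : Type*} [NormedAddCommGroup Y] [NormedSpace 𝕜 Y]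

/-- The closed linear span `[x_i]` of a sequence. -/
def closedSpan (x : ℕ → X) : Submodule 𝕜 X :=
  (Submodule.span 𝕜 (range x)).topologicalClosure

/-- A basic sequence: a Schauder basis of its closed linear span. -/
def IsBasicSeq (x : ℕ → X) : Prop :=
  ∃ b : SchauderBasis 𝕜 (closedSpan 𝕜 x), ∀ i, (b i : X) = x i

/-- Normalized sequences. -/
def IsNormalized (x : ℕ → X) : Prop := ∀ i, ‖x i‖ = 1

/-- Seminormalized sequences: norms bounded above, and bounded away from zero. -/
def IsSeminormalized (x : ℕ → X) : Prop :=
  ∃ r R : ℝ, 0 < r ∧ ∀ i, r ≤ ‖x i‖ ∧ ‖x i‖ ≤ R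

/-- `(x_i)` dominates `(y_i)`: it `C`-dominates `(y_i)` for some `C ≥ 1`. -/
def Dominates (x : ℕ → X) (y : ℕ → Y) : Prop :=
  ∃ C : ℝ, 1 ≤ C ∧ ∀ a : ℕ →₀ 𝕜,
    ‖∑ i ∈ a.support, a i • y i‖ ≤ C * ‖∑ i ∈ a.support, a i • x i‖

/-- The finite sequence `(x_i)_{i ∈ F}` `C`-dominates `(y_i)_{i ∈ F}`. -/
def DominatesOn (C : ℝ) (F : Finset ℕ) (x : ℕ → X) (y : ℕ → Y) : Prop :=
  ∀ a : ℕ → 𝕜, ‖∑ i ∈ F, a i • y i‖ ≤ C * ‖∑ i ∈ F, a i • x i‖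

/-- The inequality defining `𝓕`-unconditionality of a (basic) sequence. -/
def IsFamilyUnconditional (𝓕 : Set (Finset ℕ)) (x : ℕ → X) : Prop :=
  ∃ C : ℝ, 1 ≤ C ∧ ∀ a : ℕ →₀ 𝕜, ∀ F ∈ 𝓕,
    ‖∑ i ∈ F, a i • x i‖ ≤ C * ‖∑ i ∈ a.support, a i • x i‖

variable (X) in
/-- `X` contains `c₀`: there is an isomorphic embedding of `c₀` into `X`. -/
def ContainsC0 : Prop :=
  ∃ (T : C₀(ℕ, 𝕜) →L[𝕜] X) (r : ℝ), 0 < r ∧ ∀ f, r * ‖f‖ ≤ ‖T f‖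

variable (X) in
/-- `X` contains `c₀ⁿ`'s uniformly: for some `C` and every `n`, the `n`-dimensional space with the
sup norm embeds `C`-isomorphically into `X`. -/
def ContainsC0nUniformly : Prop :=
  ∃ C : ℝ, ∀ n : ℕ, ∃ T : (Fin n → 𝕜) →ₗ[𝕜] X, ∀ a, ‖a‖ ≤ ‖T a‖ ∧ ‖T a‖ ≤ C * ‖a‖

/-- The supremum of `‖∑ a_i x_i‖` over all finitely supported `a` such that
`‖∑_{i ∈ F} a_i y_i‖ ≤ 1 / 2 ^ n` for all `F ∈ 𝓕` and `‖∑ a_i y_i‖ ≤ 1`. -/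
def starDelta (𝓕 : Set (Finset ℕ)) (n : ℕ) (x : ℕ → X) (y : ℕ → Y) : ℝ≥0∞ :=
  ⨆ (a : ℕ →₀ 𝕜) (_ : ∀ F ∈ 𝓕, ‖∑ i ∈ F, a i • y i‖ ≤ 1 / 2 ^ n)
    (_ : ‖∑ i ∈ a.support, a i • y i‖ ≤ 1), ‖∑ i ∈ a.support, a i • x i‖ₑ

/-- The condition `(★)` of order `α` for a pair `(x_i)`, `(y_i)`. (Families of finite sets of
integers are automatically countable.) -/
def Star (α : Ordinal.{0}) (x : ℕ → X) (y : ℕ → Y) : Prop :=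
  ∃ 𝓕 : ℕ → Set (Finset ℕ),
    (∀ n, IsRegular (𝓕 n)) ∧ (∀ n, 𝓕 n ⊆ 𝓕 (n + 1)) ∧
    IsLUB (range fun n => cbIndex (𝓕 n)) (ω ^ α) ∧
    Tendsto (fun n => starDelta 𝕜 (𝓕 n) n x y) atTop (𝓝 0)

/-- `(y_i)` `α`-strongly dominates `(x_i)`. -/
structure StronglyDominates (c : Ordinal.{0} → ℕ → Ordinal.{0}) (α : Ordinal.{0})
    (y : ℕ → Y) (x : ℕ → X) : Prop where
  basic_left : IsBasicSeq 𝕜 y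
  seminormalized_left : IsSeminormalized y
  basic_right : IsBasicSeq 𝕜 x
  seminormalized_right : IsSeminormalized x
  unconditional : IsFamilyUnconditional 𝕜 (schreier c α) y
  not_containsC0 : ¬ ContainsC0 𝕜 (closedSpan 𝕜 y)
  star : Star 𝕜 α x y

variable {𝕜}

/-- The support of a vector with respect to a basis. -/
def supp (b : SchauderBasis 𝕜 X) (x : X) : Set ℕ := {i | b.coord i x ≠ 0}

/-- Block sequences with respect to a basis: `supp x₀ < supp x₁ < …`. -/
def IsBlockSeq (b : SchauderBasis 𝕜 X) (x : ℕ → X) : Prop :=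
  ∀ m n, m < n → ∀ i ∈ supp b (x m), ∀ j ∈ supp b (x n), i < j

/-- Strictly singular operators: the operator is not an isomorphism onto its image on any infinite
dimensional subspace. -/
def IsStrictlySingular (T : X →L[𝕜] Y) : Prop :=
  ∀ Z : Submodule 𝕜 X, ¬ FiniteDimensional 𝕜 Z →
    ¬ ∃ r : ℝ, 0 < r ∧ ∀ z ∈ Z, r * ‖z‖ ≤ ‖T z‖

end Sequences

end SchreierOp

end

/-! Write e_i, x_i for the sequences of assumption 1. The operator is T y_i = x_{φ(i)}, for a
subsequence φ and vectors y_i = ∑_{k ≤ i} 2^{-k} w_{k,i} of X, where (w_{k,i})_i is a subsequence of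
the block sequence that assumption 2 gives for some β_k < α, and all w_{k,i} have disjoint supports.
If A lies beyond k and φ(A) is in S_{β_k}, the supports of the w_{k,i}, i ∈ A, have union in S_α;
projecting ∑ a_i y_i onto it leaves 2^{-k} ∑_A a_i w_{k,i}. Since (e_i) is uniformly dominated by
its shifted subsequences, ‖∑_A a_i e_{φ(i)}‖ ≤ B 2^k ‖∑ a_i y_i‖. A family of index below ω^α is
contained, after passing to an infinite set of integers, in some S_β with β < α; so the estimate
holds for any prescribed families 𝓖_k of such index, with B independent of them
(`exists_dominating_sequence`).

Put C_k = B 2^k. Choose n_k with Δ_{n_k} ≤ 2^{-k} / C_{k+2}, and put ε_k = 2^{-n_k}. As E has no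
uniform c_0^n's, there is l_k such that l_k disjoint pieces of norm at least ε_k have a sum of norm
above C_{k+1}. Let 𝓖_k contain 𝓕_{n_k}, and let 𝓖_{k+1} contain 𝓖_k and all unions of l_k members of
𝓖_k; natural sums of ordinals keep the indices below ω^α (`exists_families`). The structure
`Peeling` records the outcome.

T is bounded: if ‖∑ a_i y_i‖ ≤ 1, fewer than l_k disjoint pieces over 𝓖_k can be large, so removing
a set U in 𝓖_{k+1} makes all pieces over 𝓖_k small. Doing this for successive k splits the vector
into parts to which the estimate on Δ applies, and their images have summable norms
(`Peeling.norm_le_sum_range`).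

T is strictly singular: near any infinite-dimensional subspace there are normalized vectors whose
pieces over 𝓖_k are all arbitrarily small, by induction on the index
(`Peeling.exists_small_of_indexLE`), and the same splitting started at k makes their images small. T
is not compact, because a normalized basic sequence has no convergent subsequence. -/

namespace SchreierOp

/-! ### Natural sums of ordinals -/

/-- The natural (Hessenberg) sum of two ordinals. -/
noncomputable def natSum (a b : Ordinal.{0}) : Ordinal.{0} :=
  max (⨆ x : Iio a, Order.succ (natSum x.1 b)) (⨆ x : Iio b, Order.succ (natSum a x.1))
termination_by (a, b)
decreasing_by
  · exact Prod.Lex.left _ _ x.2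
  · exact Prod.Lex.right _ x.2

theorem natSum_le_iff {a b c : Ordinal.{0}} :
    natSum a b ≤ c ↔ (∀ x < a, natSum x b < c) ∧ ∀ x < b, natSum a x < c := by
  rw [natSum, max_le_iff, Ordinal.iSup_le_iff, Ordinal.iSup_le_iff]
  simp

theorem natSum_lt_left {a a' b : Ordinal.{0}} (h : a' < a) : natSum a' b < natSum a b :=
  (natSum_le_iff.1 le_rfl).1 a' h

theorem natSum_lt_right {a b b' : Ordinal.{0}} (h : b' < b) : natSum a b' < natSum a b :=
  (natSum_le_iff.1 le_rfl).2 b' h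

/-- Natural sums add the coefficients of ω^γ without absorption. A smaller argument either has a
smaller coefficient, and then closure of ω^γ under natural sums suffices, or the same coefficient
and a smaller remainder. -/
theorem natSum_opow_mul_add_le (γ : Ordinal.{0})
    (hγ : ∀ a < ω ^ γ, ∀ b < ω ^ γ, natSum a b < ω ^ γ) (x : Ordinal.{0}) :
    ∀ y : Ordinal.{0}, ∀ (m k : ℕ) (a b : Ordinal.{0}), a < ω ^ γ → b < ω ^ γ →
      x = ω ^ γ * m + a → y = ω ^ γ * k + b →
      natSum x y ≤ ω ^ γ * (m + k : ℕ) + natSum a b := by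
  have key : ∀ (n n' : ℕ) (c d : Ordinal.{0}), n < n' → c < ω ^ γ →
      ω ^ γ * (n : Ordinal.{0}) + c < ω ^ γ * (n' : Ordinal.{0}) + d := by
    intro n n' c d hn hc
    calc ω ^ γ * (n : Ordinal.{0}) + c < ω ^ γ * (n : Ordinal.{0}) + ω ^ γ := by gcongr
      _ = ω ^ γ * ((n + 1 : ℕ) : Ordinal.{0}) := by push_cast; rw [mul_add, mul_one]
      _ ≤ ω ^ γ * (n' : Ordinal.{0}) := by gcongr; omega
      _ ≤ _ := le_self_add
  have split : ∀ (m : ℕ) (a z : Ordinal.{0}), a < ω ^ γ → z < ω ^ γ * m + a →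
      ∃ (m' : ℕ) (a' : Ordinal.{0}), a' < ω ^ γ ∧ z = ω ^ γ * m' + a' ∧
        (m' < m ∨ m' = m ∧ a' < a) := by
    intro m a z ha hz
    rcases lt_or_ge z (ω ^ γ * m) with h | h
    · obtain ⟨q, hq, r, hr, rfl⟩ := Ordinal.lt_mul_iff.1 h
      obtain ⟨q, rfl⟩ := Ordinal.lt_omega0.1 (hq.trans (Ordinal.natCast_lt_omega0 m))
      exact ⟨q, r, hr, rfl, Or.inl (by exact_mod_cast hq)⟩
    · obtain ⟨r, rfl⟩ := exists_add_of_le h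
      have hr : r < a := by simpa using hz
      exact ⟨m, r, hr.trans ha, rfl, Or.inr ⟨rfl, hr⟩⟩
  induction x using WellFoundedLT.induction with | _ x ihx
  intro y
  induction y using WellFoundedLT.induction with | _ y ihy
  intro m k a b ha hb hx hy
  rw [natSum_le_iff]
  constructor
  · intro z hz
    obtain ⟨m', a', ha', rfl, h⟩ := split m a z ha (hx ▸ hz)
    refine (ihx _ hz y m' k a' b ha' hb rfl hy).trans_lt ?_
    rcases h with h | ⟨rfl, h⟩
    · exact key _ _ _ _ (by omega) (hγ _ ha' _ hb)
    · gcongr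
      exact natSum_lt_left h
  · intro z hz
    obtain ⟨k', b', hb', rfl, h⟩ := split k b z hb (hy ▸ hz)
    refine (ihy _ hz m k' a b' ha hb' hx rfl).trans_lt ?_
    rcases h with h | ⟨rfl, h⟩
    · exact key _ _ _ _ (by omega) (hγ _ ha _ hb')
    · gcongr
      exact natSum_lt_right h

/-- This is what keeps families closed under finite unions below index ω^α. -/
theorem natSum_lt_opow (β : Ordinal.{0}) :
    ∀ a < ω ^ β, ∀ b < ω ^ β, natSum a b < ω ^ β := by
  induction β using Ordinal.limitRecOn with
  | zero =>
    intro a ha b hb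
    simp only [Ordinal.opow_zero, Order.lt_one_iff] at ha hb ⊢
    subst ha hb
    exact le_bot_iff.1 (natSum_le_iff.2 ⟨by simp, by simp⟩)
  | add_one γ ih =>
    intro a ha b hb
    rw [Ordinal.opow_add, Ordinal.opow_one] at ha hb ⊢
    obtain ⟨m, hm, a', ha', rfl⟩ := Ordinal.lt_mul_iff.1 ha
    obtain ⟨k, hk, b', hb', rfl⟩ := Ordinal.lt_mul_iff.1 hb
    obtain ⟨m, rfl⟩ := Ordinal.lt_omega0.1 hm
    obtain ⟨k, rfl⟩ := Ordinal.lt_omega0.1 hk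
    refine (natSum_opow_mul_add_le γ ih _ _ m k a' b' ha' hb' rfl rfl).trans_lt ?_
    exact Ordinal.lt_mul_iff.2 ⟨_, Ordinal.natCast_lt_omega0 _, _, ih _ ha' _ hb', rfl⟩
  | limit β hβ ih =>
    intro a ha b hb
    have h0 : (ω : Ordinal.{0}) ≠ 0 := Ordinal.omega0_ne_zero
    obtain ⟨c, hc, hac⟩ := (Ordinal.lt_opow_of_isSuccLimit h0 hβ).1 ha
    obtain ⟨d, hd, hbd⟩ := (Ordinal.lt_opow_of_isSuccLimit h0 hβ).1 hb
    have hm : max c d < β := max_lt hc hd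
    have hle : ∀ {u v : Ordinal.{0}}, u ≤ v → ω ^ u ≤ (ω : Ordinal.{0}) ^ v := fun h =>
      Ordinal.opow_le_opow_right Ordinal.omega0_pos h
    exact (ih _ hm a (hac.trans_le (hle (le_max_left _ _))) b
      (hbd.trans_le (hle (le_max_right _ _)))).trans_le (hle hm.le)

/-! ### The index of a family -/

/-- The sets `B > A` such that `A ∪ B` is in the family. -/
def sec (𝓕 : Set (Finset ℕ)) (A : Finset ℕ) : Set (Finset ℕ) :=
  {B | (∀ i ∈ A, ∀ j ∈ B, i < j) ∧ A ∪ B ∈ 𝓕}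

theorem sec_mono {𝓕 𝓖 : Set (Finset ℕ)} (h : 𝓕 ⊆ 𝓖) (A : Finset ℕ) : sec 𝓕 A ⊆ sec 𝓖 A :=
  fun _ hB => ⟨hB.1, h hB.2⟩

theorem mem_sec_singleton {𝓕 : Set (Finset ℕ)} {n : ℕ} {B : Finset ℕ} :
    B ∈ sec 𝓕 {n} ↔ (∀ j ∈ B, n < j) ∧ insert n B ∈ 𝓕 := by
  simp only [sec, mem_ofPred_eq, Finset.mem_singleton, forall_eq, Finset.singleton_union]

theorem isLowerSet_sec {𝓕 : Set (Finset ℕ)} (h : IsLowerSet 𝓕) (A : Finset ℕ) :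
    IsLowerSet (sec 𝓕 A) := fun _ _ hBC hC =>
  ⟨fun i hi j hj => hC.1 i hi j (hBC hj), h (Finset.union_subset_union_right hBC) hC.2⟩

theorem filter_gt_mem_sec {𝓕 : Set (Finset ℕ)} (h : IsLowerSet 𝓕) {A : Finset ℕ} (hA : A ∈ 𝓕)
    {n : ℕ} (hn : n ∈ A) : A.filter (n < ·) ∈ sec 𝓕 {n} := by
  rw [mem_sec_singleton]
  refine ⟨by simp, h ?_ hA⟩
  intro i hi
  simp only [Finset.mem_insert, Finset.mem_filter] at hi
  rcases hi with rfl | hi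
  exacts [hn, hi.1]

/-- The Cantor–Bendixson index of the family is at most `o`. -/
inductive IndexLE : Ordinal.{0} → Set (Finset ℕ) → Prop
  | empty (o : Ordinal.{0}) : IndexLE o ∅
  | step {o δ : Ordinal.{0}} {𝓕 : Set (Finset ℕ)} (p : ℕ) (hδ : δ < o)
      (h : ∀ n, p ≤ n → IndexLE δ (sec 𝓕 {n})) : IndexLE o 𝓕

theorem IndexLE.mono {o o' : Ordinal.{0}} {𝓕 : Set (Finset ℕ)} (h : IndexLE o 𝓕) (ho : o ≤ o') :
    IndexLE o' 𝓕 := by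
  cases h with
  | empty => exact .empty _
  | step p hδ h => exact .step p (hδ.trans_le ho) h

theorem IndexLE.subset {o : Ordinal.{0}} {𝓕 𝓖 : Set (Finset ℕ)} (h : IndexLE o 𝓕) (hs : 𝓖 ⊆ 𝓕) :
    IndexLE o 𝓖 := by
  induction h generalizing 𝓖 with
  | empty =>
    rw [subset_empty_iff.1 hs]
    exact .empty _
  | step p hδ h ih => exact .step p hδ fun n hn => ih n hn (sec_mono hs _)

theorem IndexLE.union {o : Ordinal.{0}} {𝓕 𝓖 : Set (Finset ℕ)} (hF : IndexLE o 𝓕)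
    (hG : IndexLE o 𝓖) : IndexLE o (𝓕 ∪ 𝓖) := by
  induction o using WellFoundedLT.induction generalizing 𝓕 𝓖 with | _ o ih
  cases hF with
  | empty => simpa using hG
  | step p hδ h =>
    cases hG with
    | empty => simpa using IndexLE.step p hδ h
    | step q hδ' h' =>
      refine .step (max p q) (max_lt hδ hδ') fun n hn => ?_
      have := ih _ (max_lt hδ hδ') ((h n (le_of_max_le_left hn)).mono (le_max_left _ _))
        ((h' n (le_of_max_le_right hn)).mono (le_max_right _ _))
      exact this.subset fun B hB => hB.2.imp (fun h => ⟨hB.1, h⟩) (fun h => ⟨hB.1, h⟩)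

theorem IndexLE.biUnion {ι : Type*} {o : Ordinal.{0}} (s : Finset ι) {𝓕 : ι → Set (Finset ℕ)}
    (h : ∀ i ∈ s, IndexLE o (𝓕 i)) : IndexLE o (⋃ i ∈ s, 𝓕 i) := by
  classical
  induction s using Finset.induction_on with
  | empty => simpa using IndexLE.empty o
  | insert i s hi ih =>
    rw [Finset.set_biUnion_insert]
    exact (h i (by simp)).union (ih fun j hj => h j (by simp [hj]))

theorem indexLE_singleton_empty : IndexLE 1 {∅} := by
  refine .step 0 zero_lt_one fun n _ => ?_
  have : sec {∅} {n} = ∅ := by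
    ext B
    simp [mem_sec_singleton]
  rw [this]
  exact .empty _

/-- The unions of a member of `𝓕` and a member of `𝓖`. -/
def join (𝓕 𝓖 : Set (Finset ℕ)) : Set (Finset ℕ) := {C | ∃ A ∈ 𝓕, ∃ B ∈ 𝓖, C = A ∪ B}

/-- The least element n of the union may come from the first set, from the second, or from both;
these are the three terms. -/
theorem sec_join_subset (𝓕 𝓖 : Set (Finset ℕ)) (n : ℕ) :
    sec (join 𝓕 𝓖) {n} ⊆
      (join (sec 𝓕 {n}) 𝓖 ∪ join 𝓕 (sec 𝓖 {n})) ∪ join (sec 𝓕 {n}) (sec 𝓖 {n}) := by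
  intro C hC
  rw [mem_sec_singleton] at hC
  obtain ⟨hnC, A, hA, B, hB, hAB⟩ := hC
  have hn : n ∉ C := fun h => (hnC n h).false
  have hC' : C = A.erase n ∪ B.erase n := by
    rw [← Finset.erase_union_distrib, ← hAB, Finset.erase_insert hn]
  have hsec : ∀ {𝓗 : Set (Finset ℕ)} {D : Finset ℕ}, D ∈ 𝓗 → D ⊆ insert n C → n ∈ D →
      D.erase n ∈ sec 𝓗 {n} := by
    intro 𝓗 D hD hDC hnD
    rw [mem_sec_singleton, Finset.insert_erase hnD]
    refine ⟨fun j hj => ?_, hD⟩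
    rw [Finset.mem_erase] at hj
    rcases Finset.mem_insert.1 (hDC hj.2) with h | h
    exacts [absurd h hj.1, hnC j h]
  have hAC : A ⊆ insert n C := hAB ▸ Finset.subset_union_left
  have hBC : B ⊆ insert n C := hAB ▸ Finset.subset_union_right
  have hnAB : n ∈ A ∪ B := hAB ▸ Finset.mem_insert_self _ _
  by_cases hnA : n ∈ A
  · by_cases hnB : n ∈ B
    · exact Or.inr ⟨_, hsec hA hAC hnA, _, hsec hB hBC hnB, hC'⟩
    · refine Or.inl (Or.inl ⟨_, hsec hA hAC hnA, B, hB, ?_⟩)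
      rwa [Finset.erase_eq_of_notMem hnB] at hC'
  · have hnB : n ∈ B := (Finset.mem_union.1 hnAB).resolve_left hnA
    refine Or.inl (Or.inr ⟨A, hA, _, hsec hB hBC hnB, ?_⟩)
    rwa [Finset.erase_eq_of_notMem hnA] at hC'

theorem IndexLE.join {o o' : Ordinal.{0}} {𝓕 𝓖 : Set (Finset ℕ)} (hF : IndexLE o 𝓕)
    (hG : IndexLE o' 𝓖) : IndexLE (natSum o o') (join 𝓕 𝓖) := by
  induction hF generalizing o' 𝓖 with
  | empty =>
    have : SchreierOp.join ∅ 𝓖 = ∅ := by ext; simp [SchreierOp.join]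
    rw [this]
    exact .empty _
  | @step o δ 𝓕 p hδ hF ihF =>
    induction hG with
    | empty =>
      have : SchreierOp.join 𝓕 ∅ = ∅ := by ext; simp [SchreierOp.join]
      rw [this]
      exact .empty _
    | @step o' δ' 𝓖 q hδ' hG ihG =>
      have h₁ : natSum δ o' < natSum o o' := natSum_lt_left hδ
      have h₂ : natSum o δ' < natSum o o' := natSum_lt_right hδ'
      have h₃ : natSum δ δ' < natSum δ o' := natSum_lt_right hδ'
      refine .step (max p q) (max_lt h₁ h₂) fun n hn => ?_
      have hp := le_of_max_le_left hn
      have hq := le_of_max_le_right hn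
      refine IndexLE.subset ?_ (sec_join_subset 𝓕 𝓖 n)
      exact (((ihF n hp (.step q hδ' hG)).mono (le_max_left _ _)).union
        ((ihG n hq).mono (le_max_right _ _))).union
        ((ihF n hp (hG n hq)).mono (h₃.le.trans (le_max_left _ _)))

/-- The unions of at most `l` members of `𝓕`. -/
def unions (l : ℕ) (𝓕 : Set (Finset ℕ)) : Set (Finset ℕ) :=
  {A | ∃ s : Finset (Finset ℕ), s.card ≤ l ∧ (∀ F ∈ s, F ∈ 𝓕) ∧ A = s.biUnion id}

theorem isLowerSet_unions (l : ℕ) {𝓕 : Set (Finset ℕ)} (h : IsLowerSet 𝓕) :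
    IsLowerSet (unions l 𝓕) := by
  rintro _ B hBA ⟨s, hs, hF, rfl⟩
  refine ⟨s.image (· ∩ B), Finset.card_image_le.trans hs, ?_, ?_⟩
  · simp only [Finset.mem_image]
    rintro _ ⟨F, hFs, rfl⟩
    exact h Finset.inter_subset_left (hF F hFs)
  · ext i
    simp only [Finset.mem_biUnion, Finset.mem_image, id]
    constructor
    · intro hi
      obtain ⟨F, hF, hiF⟩ := Finset.mem_biUnion.1 (hBA hi)
      exact ⟨_, ⟨F, hF, rfl⟩, Finset.mem_inter.2 ⟨hiF, hi⟩⟩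
    · rintro ⟨_, ⟨F, -, rfl⟩, hi⟩
      exact (Finset.mem_inter.1 hi).2

theorem exists_indexLE_unions {β o : Ordinal.{0}} {𝓕 : Set (Finset ℕ)} (hβ : β ≠ 0)
    (h : IndexLE o 𝓕) (ho : o < ω ^ β) (l : ℕ) :
    ∃ o' < ω ^ β, IndexLE o' (unions l 𝓕) := by
  have h1 : (1 : Ordinal.{0}) < ω ^ β := Ordinal.one_lt_opow.2 ⟨Ordinal.one_lt_omega0, hβ⟩
  induction l with
  | zero =>
    refine ⟨1, h1, indexLE_singleton_empty.subset ?_⟩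
    rintro _ ⟨s, hs, -, rfl⟩
    simp [Finset.card_eq_zero.1 (Nat.le_zero.1 hs)]
  | succ l ih =>
    obtain ⟨o', ho', hu⟩ := ih
    refine ⟨max 1 (natSum o o'), max_lt h1 (natSum_lt_opow β _ ho _ ho'),
      ((indexLE_singleton_empty.mono (le_max_left _ _)).union
        ((h.join hu).mono (le_max_right _ _))).subset ?_⟩
    rintro _ ⟨s, hs, hF, rfl⟩
    rcases s.eq_empty_or_nonempty with rfl | ⟨F, hFs⟩
    · exact Or.inl (by simp)
    · refine Or.inr ⟨F, hF F hFs, (s.erase F).biUnion id, ⟨s.erase F, ?_, ?_, rfl⟩, ?_⟩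
      · rw [Finset.card_erase_of_mem hFs]
        omega
      · exact fun G hG => hF G (Finset.mem_of_mem_erase hG)
      · conv_lhs => rw [← Finset.insert_erase hFs, Finset.biUnion_insert]
        rfl

theorem IndexLE.preimage {o : Ordinal.{0}} {𝓕 : Set (Finset ℕ)} (h : IndexLE o 𝓕) {φ : ℕ → ℕ}
    (hφ : StrictMono φ) : IndexLE o {A | A.image φ ∈ 𝓕} := by
  induction h with
  | empty =>
    have : {A : Finset ℕ | A.image φ ∈ (∅ : Set (Finset ℕ))} = ∅ := by ext; simp
    rw [this]
    exact .empty _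
  | step p hδ h ih =>
    refine .step p hδ fun n hn => (ih (φ n) (hn.trans hφ.le_apply)).subset ?_
    intro B hB
    rw [mem_sec_singleton] at hB
    change B.image φ ∈ sec _ _
    rw [mem_sec_singleton]
    refine ⟨?_, ?_⟩
    · simp only [Finset.mem_image]
      rintro _ ⟨j, hj, rfl⟩
      exact hφ (hB.1 j hj)
    · have := hB.2
      rwa [mem_ofPred_eq, Finset.image_insert] at this

/-! ### Comparison with the topological index -/

/-- A finite set as a point of the Cantor space. -/
def toPoint (A : Finset ℕ) : ℕ → Bool := fun i => decide (i ∈ A)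

theorem toPoint_injective : Function.Injective toPoint := by
  intro A B h
  ext i
  simpa [toPoint] using congrFun h i

theorem tendsto_toPoint_insert (A : Finset ℕ) :
    Tendsto (fun n => toPoint (insert n A)) atTop (𝓝 (toPoint A)) := by
  rw [tendsto_pi_nhds]
  intro i
  refine tendsto_const_nhds.congr' ?_
  filter_upwards [eventually_gt_atTop i] with n hn
  simp [toPoint, hn.ne]

/-- The points A ∪ {n} converge to A. If the section at A has index above δ + 1, then for
arbitrarily large n the section at A ∪ {n} has index above δ, so A is an accumulation point of the
δ-th derivative. -/
theorem toPoint_mem_iteratedDerivedSet {𝓕 : Set (Finset ℕ)} (h𝓕 : IsLowerSet 𝓕)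
    (o : Ordinal.{0}) : ∀ A : Finset ℕ, ¬ IndexLE o (sec 𝓕 A) →
      toPoint A ∈ CantorBendixson.iteratedDerivedSet (toCantor 𝓕) o := by
  induction o using Ordinal.limitRecOn with
  | zero =>
    intro A hA
    have hne : (sec 𝓕 A).Nonempty := by
      by_contra h
      rw [not_nonempty_iff_eq_empty.1 h] at hA
      exact hA (.empty _)
    obtain ⟨B, hB⟩ := hne
    rw [CantorBendixson.iteratedDerivedSet_zero]
    exact ⟨A, h𝓕 Finset.subset_union_left hB.2, rfl⟩
  | add_one δ ih =>
    intro A hA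
    rw [CantorBendixson.iteratedDerivedSet_succ, relDerivedSet_apply]
    refine ⟨?_, ih A fun h => hA (h.mono le_self_add)⟩
    rw [mem_derivedSet, accPt_iff_frequently]
    refine (tendsto_toPoint_insert A).frequently ?_
    rw [frequently_atTop]
    intro p
    by_contra! hp
    refine hA (.step (max p (A.sup id + 1)) (lt_add_one δ) fun n hn => ?_)
    have hnA : ∀ i ∈ A, i < n := fun i hi =>
      (Nat.lt_succ_of_le (Finset.le_sup (f := id) hi)).trans_le (le_of_max_le_right hn)
    have hn' : n ∉ A := fun h => (hnA n h).false
    by_contra hcon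
    refine hp n (le_of_max_le_left hn) (fun h => ?_) (ih _ fun h => hcon (h.subset ?_))
    · exact hn' ((toPoint_injective h) ▸ Finset.mem_insert_self n A)
    · intro B hB
      rw [mem_sec_singleton] at hB
      refine ⟨?_, ?_⟩
      · intro i hi j hj
        rcases Finset.mem_insert.1 hi with rfl | hi
        · exact hB.1 j hj
        · exact (hnA i hi).trans (hB.1 j hj)
      · have := hB.2.2
        rwa [Finset.union_insert, ← Finset.insert_union] at this
  | limit o ho ih =>
    intro A hA
    rw [CantorBendixson.iteratedDerivedSet_limit ho, mem_iInter]
    exact fun δ => ih δ.1 δ.2 A fun h => hA (h.mono δ.2.le)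

/-- A nonempty perfect set contains a copy of the Cantor space and is uncountable, so the perfect
kernel of S is empty. Hence the infimum defining `cbIndex` is attained. -/
theorem exists_iteratedDerivedSet_eq_empty {S : Set (ℕ → Bool)} (hS : IsClosed S)
    (hc : S.Countable) : ∃ o : Ordinal.{0}, CantorBendixson.iteratedDerivedSet S o = ∅ := by
  obtain ⟨o, ho⟩ := CantorBendixson.iteratedDerivedSet_mem_fixedPoints S
  refine ⟨o, ?_⟩
  rw [← CantorBendixson.perfectKernel_eq_iteratedDerivedSet_of_mem_fixedPoints ho]
  by_contra hne
  let _ := TopologicalSpace.upgradeIsCompletelyMetrizable (ℕ → Bool)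
  obtain ⟨f, hf, -, hinj⟩ := (CantorBendixson.perfect_perfectKernel hS).exists_nat_bool_injection
    (nonempty_iff_ne_empty.2 hne)
  have hr : (range f).Countable := hc.mono (hf.trans (CantorBendixson.perfectKernel_subset S))
  have := hr.to_subtype
  have : Countable (ℕ → Bool) := (Set.rangeFactorization_injective.2 hinj).countable
  obtain ⟨g, hg⟩ := exists_surjective_nat (ℕ → Bool)
  obtain ⟨n, hn⟩ := hg fun k => !(g k k)
  simpa using congrFun hn n

theorem IsRegular.isLowerSet {𝓕 : Set (Finset ℕ)} (h : IsRegular 𝓕) : IsLowerSet 𝓕 :=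
  fun A B hBA hA => h.hereditary A hA B hBA

theorem IsRegular.indexLE {𝓕 : Set (Finset ℕ)} (h : IsRegular 𝓕) : IndexLE (cbIndex 𝓕) 𝓕 := by
  have hne : CantorBendixson.iteratedDerivedSet (toCantor 𝓕) (cbIndex 𝓕) = ∅ :=
    csInf_mem (s := {o | CantorBendixson.iteratedDerivedSet (toCantor 𝓕) o = ∅})
      (exists_iteratedDerivedSet_eq_empty h.compact.isClosed ((to_countable 𝓕).image _))
  by_contra hcon
  have := toPoint_mem_iteratedDerivedSet h.isLowerSet (cbIndex 𝓕) ∅ fun h' =>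
    hcon (h'.subset fun B hB => ⟨by simp, by simpa using hB⟩)
  rw [hne] at this
  exact this

/-- A single δ bounds all but finitely many sections, so a limit bound is never sharp. This turns
index at most ω^α into index strictly below it. -/
theorem IndexLE.exists_lt {o : Ordinal.{0}} {𝓕 : Set (Finset ℕ)} (h : IndexLE o 𝓕)
    (ho : Order.IsSuccLimit o) : ∃ o' < o, IndexLE o' 𝓕 := by
  cases h with
  | empty => exact ⟨0, ho.bot_lt, .empty _⟩
  | @step _ δ _ p hδ h => exact ⟨δ + 1, ho.succ_lt hδ, .step p (lt_add_one δ) h⟩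

/-! ### Thinning -/

/-- Thin repeatedly, each time for the property attached to the least element of the current set,
and collect these least elements. -/
theorem exists_infinite_diagonal (P : ℕ → Set ℕ → Prop)
    (hmono : ∀ n M M', M ⊆ M' → P n M' → P n M)
    (hP : ∀ n, ∀ N : Set ℕ, N.Infinite → ∃ M ⊆ N, M.Infinite ∧ P n M)
    (N : Set ℕ) (hN : N.Infinite) :
    ∃ M ⊆ N, M.Infinite ∧ ∀ n ∈ M, P n (M ∩ Ioi n) := by
  choose f hfs hfi hfP using hP
  let step : {S : Set ℕ // S.Infinite} → {S : Set ℕ // S.Infinite} := fun S =>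
    ⟨f (sInf S.1) (S.1 ∩ Ioi (sInf S.1)) (S.2.sdiff (finite_Iic _) |>.mono (by
      intro x hx; exact ⟨hx.1, not_le.1 (mem_Iic.not.1 hx.2)⟩)), hfi _ _ _⟩
  let S : ℕ → {S : Set ℕ // S.Infinite} := fun k => step^[k] ⟨N, hN⟩
  have hS : ∀ k, S (k + 1) = step (S k) := fun k => Function.iterate_succ_apply' _ _ _
  have hsub : ∀ k, (S (k + 1)).1 ⊆ (S k).1 ∩ Ioi (sInf (S k).1) := by
    intro k
    rw [hS]
    exact hfs _ _ _
  have hanti : Antitone fun k => (S k).1 :=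
    antitone_nat_of_succ_le fun k => (hsub k).trans inter_subset_left
  let m : ℕ → ℕ := fun k => sInf (S k).1
  have hm : ∀ k, m k ∈ (S k).1 := fun k => Nat.sInf_mem (S k).2.nonempty
  have hmm : StrictMono m := strictMono_nat_of_lt_succ fun k => (hsub k (hm (k + 1))).2
  refine ⟨range m, ?_, infinite_range_of_injective hmm.injective, ?_⟩
  · rintro _ ⟨k, rfl⟩
    exact hanti (Nat.zero_le k) (hm k)
  · rintro _ ⟨k, rfl⟩
    refine hmono _ _ (S (k + 1)).1 ?_ ?_
    · rintro _ ⟨⟨j, rfl⟩, hj⟩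
      exact hanti (hmm.lt_iff_lt.1 hj) (hm j)
    · rw [hS]
      exact hfP _ _ _

/-- The empty set belongs to the `o`-th derivative of the family. -/
inductive IndexGT : Ordinal.{0} → Set (Finset ℕ) → Prop
  | intro {o : Ordinal.{0}} {𝓕 : Set (Finset ℕ)} (h0 : ∅ ∈ 𝓕) (p : Ordinal.{0} → ℕ)
      (h : ∀ δ < o, ∀ n, p δ ≤ n → IndexGT δ (sec 𝓕 {n})) : IndexGT o 𝓕

theorem indexGT_iff {o : Ordinal.{0}} {𝓕 : Set (Finset ℕ)} :
    IndexGT o 𝓕 ↔ ∅ ∈ 𝓕 ∧ ∀ δ < o, ∃ p : ℕ, ∀ n, p ≤ n → IndexGT δ (sec 𝓕 {n}) := by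
  constructor
  · rintro ⟨h0, p, h⟩
    exact ⟨h0, fun δ hδ => ⟨p δ, h δ hδ⟩⟩
  · rintro ⟨h0, h⟩
    choose! p hp using h
    exact .intro h0 p hp

theorem IndexGT.superset {o : Ordinal.{0}} {𝓕 𝓖 : Set (Finset ℕ)} (h : IndexGT o 𝓕) (hs : 𝓕 ⊆ 𝓖) :
    IndexGT o 𝓖 := by
  induction h generalizing 𝓖 with
  | intro h0 p h ih => exact .intro (hs h0) p fun δ hδ n hn => ih δ hδ n hn (sec_mono hs _)

/-- Induction on the index: the sections at n can be compared after thinning beyond n, and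
diagonalizing handles all n at once. A member of 𝓕 is then transferred through the section at its
least element. -/
theorem IndexLE.exists_thin {o : Ordinal.{0}} {𝓕 : Set (Finset ℕ)} (hF : IndexLE o 𝓕) :
    ∀ {𝓖 : Set (Finset ℕ)}, IndexGT o 𝓖 → ∀ N : Set ℕ, N.Infinite →
      ∃ M ⊆ N, M.Infinite ∧ ∀ A ∈ 𝓕, (A : Set ℕ) ⊆ M → A ∈ 𝓖 := by
  induction hF with
  | empty => exact fun _ N hN => ⟨N, Subset.rfl, hN, by simp⟩
  | @step o δ 𝓕 p hδ h ih =>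
    intro 𝓖 hG N hN
    obtain ⟨h0, hG⟩ := indexGT_iff.1 hG
    obtain ⟨q, hq⟩ := hG δ hδ
    obtain ⟨M, hMN, hM, hP⟩ := exists_infinite_diagonal
      (fun n M => p ≤ n → q ≤ n → ∀ A ∈ sec 𝓕 {n}, (A : Set ℕ) ⊆ M → A ∈ sec 𝓖 {n})
      (fun n M M' hMM' h hp hq A hA hAM => h hp hq A hA (hAM.trans hMM'))
      (by
        intro n N hN
        by_cases hpq : p ≤ n ∧ q ≤ n
        · obtain ⟨M, h1, h2, h3⟩ := ih n hpq.1 (hq n hpq.2) N hN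
          exact ⟨M, h1, h2, fun _ _ => h3⟩
        · exact ⟨N, Subset.rfl, hN, fun h1 h2 => absurd ⟨h1, h2⟩ hpq⟩)
      (N \ Iic (max p q)) (hN.sdiff (finite_Iic _))
    refine ⟨M, hMN.trans sdiff_subset, hM, fun A hA hAM => ?_⟩
    rcases A.eq_empty_or_nonempty with rfl | hne
    · exact h0
    · set n := A.min' hne with hn
      have hnA : n ∈ A := A.min'_mem hne
      have hnM : n ∈ M := hAM hnA
      have hpq : max p q < n := not_le.1 (hMN hnM).2
      have hgt : ∀ j ∈ A.erase n, n < j := fun j hj =>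
        lt_of_le_of_ne (A.min'_le j (Finset.mem_of_mem_erase hj)) (Finset.ne_of_mem_erase hj).symm
      have hmem : A.erase n ∈ sec 𝓕 {n} := by
        rw [mem_sec_singleton, Finset.insert_erase hnA]
        exact ⟨hgt, hA⟩
      have := hP n hnM ((le_max_left _ _).trans hpq.le) ((le_max_right _ _).trans hpq.le) _ hmem
        (fun j hj => ⟨hAM (Finset.mem_of_mem_erase hj), hgt j hj⟩)
      rw [mem_sec_singleton, Finset.insert_erase hnA] at this
      exact this.2

/-! ### Schreier families -/

theorem image_mem_schreier (c : Ordinal.{0} → ℕ → Ordinal.{0}) {f : ℕ → ℕ} (hf : StrictMono f)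
    (β : Ordinal.{0}) : ∀ A ∈ schreier c β, A.image f ∈ schreier c β := by
  induction β using Ordinal.limitRecOn with
  | zero =>
    rw [schreier_zero]
    exact fun A hA => Finset.card_image_le.trans hA
  | add_one β ih =>
    rw [schreier_add_one]
    rintro _ ⟨k, G, hG, hk, hlt, rfl⟩
    refine ⟨k, fun j => (G j).image f, fun j => ih _ (hG j), ?_, ?_, Finset.biUnion_image⟩
    · intro j i hi
      obtain ⟨m, hm, rfl⟩ := Finset.mem_image.1 hi
      exact (hk j m hm).trans (Nat.succ_le_succ hf.le_apply)
    · intro j j' hj i hi i' hi'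
      obtain ⟨m, hm, rfl⟩ := Finset.mem_image.1 hi
      obtain ⟨m', hm', rfl⟩ := Finset.mem_image.1 hi'
      exact hf (hlt j j' hj m hm m' hm')
  | limit β hβ ih =>
    rw [schreier_limit c β hβ]
    rintro A ⟨n, hn, hA, hle⟩
    refine ⟨n, hn, ih _ hn A hA, fun i hi => ?_⟩
    obtain ⟨m, hm, rfl⟩ := Finset.mem_image.1 hi
    exact (hle m hm).trans hf.le_apply

theorem schreier_subset_add_one (c : Ordinal.{0} → ℕ → Ordinal.{0}) (β : Ordinal.{0}) :
    schreier c β ⊆ schreier c (β + 1) := by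
  rw [schreier_add_one]
  intro A hA
  exact ⟨1, fun _ => A, fun _ => hA, fun _ i _ => Nat.le_add_left 1 i,
    fun j j' hj => absurd hj (by simp [Subsingleton.elim j j']), by simp⟩

theorem IsApproximating.exists_lt {c : Ordinal.{0} → ℕ → Ordinal.{0}} (hc : IsApproximating c)
    {β γ : Ordinal.{0}} (hβ : Order.IsSuccLimit β) (hβ₁ : β < ω₁) (h : γ < β) :
    ∃ n, γ < c β n := by
  obtain ⟨_, ⟨n, rfl⟩, hn⟩ := (lt_isLUB_iff (hc β hβ hβ₁).2.2).1 h
  exact ⟨n, hn⟩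

theorem empty_mem_schreier {c : Ordinal.{0} → ℕ → Ordinal.{0}} (hc : IsApproximating c)
    (β : Ordinal.{0}) (hβ₁ : β < ω₁) : ∅ ∈ schreier c β := by
  induction β using Ordinal.limitRecOn with
  | zero => simp [schreier_zero]
  | add_one β ih => exact schreier_subset_add_one c β (ih ((lt_add_one β).trans hβ₁))
  | limit β hβ ih =>
    rw [schreier_limit c β hβ]
    have := (hc β hβ hβ₁).2.1 0
    exact ⟨0, this, ih _ this (this.trans hβ₁), by simp⟩

theorem exists_tail_schreier_subset {c : Ordinal.{0} → ℕ → Ordinal.{0}} (hc : IsApproximating c)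
    (β : Ordinal.{0}) (hβ₁ : β < ω₁) : ∀ γ ≤ β, ∃ q : ℕ, ∀ A ∈ schreier c γ,
      (∀ i ∈ A, q ≤ i) → A ∈ schreier c β := by
  induction β using Ordinal.limitRecOn with
  | zero =>
    intro γ hγ
    rw [nonpos_iff_eq_zero.1 hγ]
    exact ⟨0, fun A hA _ => hA⟩
  | add_one β ih =>
    intro γ hγ
    rcases hγ.lt_or_eq with h | rfl
    · obtain ⟨q, hq⟩ := ih ((lt_add_one β).trans hβ₁) γ (Order.lt_add_one_iff.1 h)
      exact ⟨q, fun A hA hAq => schreier_subset_add_one c β (hq A hA hAq)⟩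
    · exact ⟨0, fun A hA _ => hA⟩
  | limit β hβ ih =>
    intro γ hγ
    rcases hγ.lt_or_eq with h | rfl
    · obtain ⟨n, hn⟩ := hc.exists_lt hβ hβ₁ h
      have hnβ := (hc β hβ hβ₁).2.1 n
      obtain ⟨q, hq⟩ := ih _ hnβ (hnβ.trans hβ₁) γ hn.le
      refine ⟨max q n, fun A hA hAq => ?_⟩
      rw [schreier_limit c β hβ]
      exact ⟨n, hnβ, hq A hA fun i hi => le_of_max_le_left (hAq i hi),
        fun i hi => le_of_max_le_right (hAq i hi)⟩
    · exact ⟨0, fun A hA _ => hA⟩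

/-- Replacing the points of a set in S_β by successive sets of S_r gives a set in S_{r+β}, provided
the blocks lie far out. The bound h is needed because the approximating sequences of β and r + β are
unrelated at limits. -/
theorem exists_biUnion_mem_schreier {c : Ordinal.{0} → ℕ → Ordinal.{0}} (hc : IsApproximating c)
    (r β : Ordinal.{0}) (hβ₁ : r + β < ω₁) : ∃ h : ℕ → ℕ, ∀ A ∈ schreier c β,
      ∀ H : ℕ → Finset ℕ, (∀ i ∈ A, H i ∈ schreier c r) →
      (∀ i ∈ A, ∀ i' ∈ A, i < i' → ∀ j ∈ H i, ∀ j' ∈ H i', j < j') →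
      (∀ i ∈ A, ∀ j ∈ H i, h i ≤ j) → A.biUnion H ∈ schreier c (r + β) := by
  induction β using Ordinal.limitRecOn with
  | zero =>
    refine ⟨0, fun A hA H hH _ _ => ?_⟩
    rw [schreier_zero] at hA
    rw [add_zero] at hβ₁ ⊢
    rcases A.eq_empty_or_nonempty with rfl | ⟨i, hi⟩
    · simpa using empty_mem_schreier hc r hβ₁
    · have : A = {i} := Finset.eq_singleton_iff_unique_mem.2
        ⟨hi, fun j hj => Finset.card_le_one.1 hA j hj i hi⟩
      subst this
      simpa using hH i hi
  | add_one β ih =>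
    rw [← add_assoc] at hβ₁
    obtain ⟨h, hh⟩ := ih ((lt_add_one _).trans hβ₁)
    refine ⟨fun i => max (h i) i, fun A hA H hH hlt hle => ?_⟩
    rw [← add_assoc, schreier_add_one]
    rw [schreier_add_one] at hA
    obtain ⟨k, G, hG, hk, hGlt, rfl⟩ := hA
    have hmem : ∀ j, ∀ i ∈ G j, i ∈ Finset.univ.biUnion G := fun j i hi =>
      Finset.mem_biUnion.2 ⟨j, Finset.mem_univ _, hi⟩
    refine ⟨k, fun j => (G j).biUnion H, fun j => ?_, ?_, ?_, ?_⟩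
    · exact hh _ (hG j) H (fun i hi => hH i (hmem j i hi))
        (fun i hi i' hi' => hlt i (hmem j i hi) i' (hmem j i' hi'))
        (fun i hi m hm => le_of_max_le_left (hle i (hmem j i hi) m hm))
    · intro j m hm
      obtain ⟨i, hi, hm⟩ := Finset.mem_biUnion.1 hm
      exact (hk j i hi).trans (Nat.succ_le_succ (le_of_max_le_right (hle i (hmem j i hi) m hm)))
    · intro j j' hj m hm m' hm'
      obtain ⟨i, hi, hm⟩ := Finset.mem_biUnion.1 hm
      obtain ⟨i', hi', hm'⟩ := Finset.mem_biUnion.1 hm'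
      exact hlt i (hmem j i hi) i' (hmem j' i' hi') (hGlt j j' hj i hi i' hi') m hm m' hm'
    · exact Finset.biUnion_biUnion _ _ _
  | limit β hβ ih =>
    have hlim := hc β hβ ((le_add_self).trans_lt hβ₁)
    have hlt' : ∀ n, r + c β n < r + β := fun n => by
      have := hlim.2.1 n
      gcongr
    choose h hh using fun n => ih _ (hlim.2.1 n) ((hlt' n).trans hβ₁)
    choose q hq using fun n => exists_tail_schreier_subset hc (r + β) hβ₁ _ (hlt' n).le
    -- The approximating index n through which A is in S_β depends on A but is at most every i ∈ A;
    -- the bound at i therefore covers all n ≤ i.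
    refine ⟨fun i => (Finset.range (i + 1)).sup fun n => max (h n i) (q n),
      fun A hA H hH hlt hle => ?_⟩
    rw [schreier_limit c β hβ] at hA
    obtain ⟨n, hn, hA, hnA⟩ := hA
    have hle' : ∀ i ∈ A, ∀ j ∈ H i, max (h n i) (q n) ≤ j := fun i hi j hj =>
      (Finset.le_sup (f := fun n => max (h n i) (q n))
        (Finset.mem_range.2 (Nat.lt_succ_of_le (hnA i hi)))).trans (hle i hi j hj)
    refine hq n _ (hh n A hA H hH hlt fun i hi j hj => le_of_max_le_left (hle' i hi j hj)) ?_
    intro j hj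
    obtain ⟨i, hi, hj⟩ := Finset.mem_biUnion.1 hj
    exact le_of_max_le_right (hle' i hi j hj)

theorem IndexGT.tail {o : Ordinal.{0}} {𝓕 : Set (Finset ℕ)} (h : IndexGT o 𝓕) (n : ℕ) :
    IndexGT o {A | A ∈ 𝓕 ∧ ∀ i ∈ A, n < i} := by
  cases h with
  | intro h0 p h =>
    refine .intro ⟨h0, by simp⟩ (fun δ => max (p δ) (n + 1)) fun δ hδ m hm =>
      (h δ hδ m (le_of_max_le_left hm)).superset fun B hB => ?_
    rw [mem_sec_singleton] at hB ⊢
    have hnm : n < m := le_of_max_le_right hm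
    refine ⟨hB.1, hB.2, fun i hi => ?_⟩
    rcases Finset.mem_insert.1 hi with rfl | hi
    exacts [hnm, hnm.trans (hB.1 i hi)]

/-- The unions of a member of `𝓕` and a later member of `𝓖`. -/
def succJoin (𝓕 𝓖 : Set (Finset ℕ)) : Set (Finset ℕ) :=
  {C | ∃ A ∈ 𝓕, ∃ B ∈ 𝓖, (∀ i ∈ A, ∀ j ∈ B, i < j) ∧ C = A ∪ B}

/-- The later set is exhausted first when deriving, which is why its index b stands on the left.
Below b the first set may be taken empty; above b, an element of the first set is removed. -/
theorem IndexGT.succJoin {a b : Ordinal.{0}} {𝓕 𝓖 : Set (Finset ℕ)} (hF : IndexGT a 𝓕)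
    (hG : IndexGT b 𝓖) : IndexGT (b + a) (succJoin 𝓕 𝓖) := by
  induction hF generalizing 𝓖 with
  | @intro a 𝓕 h0 p h ih =>
    have hsub : 𝓖 ⊆ SchreierOp.succJoin 𝓕 𝓖 := fun B hB => ⟨∅, h0, B, hB, by simp, by simp⟩
    obtain ⟨h0', hG'⟩ := indexGT_iff.1 hG
    rw [indexGT_iff]
    refine ⟨hsub h0', fun δ hδ => ?_⟩
    rcases lt_or_ge δ b with hb | hb
    · obtain ⟨q, hq⟩ := hG' δ hb
      exact ⟨q, fun n hn => (hq n hn).superset (sec_mono hsub _)⟩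
    · obtain ⟨δ, rfl⟩ := exists_add_of_le hb
      have hδa : δ < a := by simpa using hδ
      refine ⟨p δ, fun n hn => (ih δ hδa n hn (hG.tail n)).superset ?_⟩
      rintro _ ⟨A, hA, B, ⟨hB, hnB⟩, hAB, rfl⟩
      rw [mem_sec_singleton] at hA ⊢
      refine ⟨fun j hj => ?_, insert n A, hA.2, B, hB, ?_, by rw [Finset.insert_union]⟩
      · rcases Finset.mem_union.1 hj with hj | hj
        exacts [hA.1 j hj, hnB j hj]
      · intro i hi j hj
        rcases Finset.mem_insert.1 hi with rfl | hi
        exacts [hnB j hj, hAB i hi j hj]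

/-- The unions of `k` successive members of `𝓕`. -/
def succUnions (k : ℕ) (𝓕 : Set (Finset ℕ)) : Set (Finset ℕ) :=
  {A | ∃ G : Fin k → Finset ℕ, (∀ j, G j ∈ 𝓕) ∧
    (∀ j j', j < j' → ∀ i ∈ G j, ∀ i' ∈ G j', i < i') ∧ A = Finset.univ.biUnion G}

theorem succJoin_succUnions_subset (k : ℕ) (𝓕 : Set (Finset ℕ)) :
    succJoin 𝓕 (succUnions k 𝓕) ⊆ succUnions (k + 1) 𝓕 := by
  rintro _ ⟨A, hA, _, ⟨G, hG, hlt, rfl⟩, hAB, rfl⟩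
  refine ⟨Fin.cons A G, fun j => ?_, fun j j' hj => ?_, ?_⟩
  · induction j using Fin.cases with
    | zero => exact hA
    | succ j => exact hG j
  · induction j' using Fin.cases with
    | zero => exact absurd hj (Fin.not_lt_zero j)
    | succ j' =>
      induction j using Fin.cases with
      | zero =>
        intro i hi i' hi'
        exact hAB i hi i' (Finset.mem_biUnion.2 ⟨j', Finset.mem_univ _, hi'⟩)
      | succ j => exact hlt j j' (Fin.succ_lt_succ_iff.1 hj)
  · ext i
    simp [Fin.exists_fin_succ]

theorem IndexGT.succUnions {o : Ordinal.{0}} {𝓕 : Set (Finset ℕ)} (h : IndexGT o 𝓕) (k : ℕ) :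
    IndexGT (o * k) (succUnions k 𝓕) := by
  induction k with
  | zero =>
    refine .intro ⟨fun _ => ∅, by simp, by simp, by simp⟩ 0 fun δ hδ => ?_
    simp at hδ
  | succ k ih =>
    push_cast
    rw [mul_add, mul_one]
    exact (h.succJoin ih).superset (succJoin_succUnions_subset k 𝓕)

theorem indexGT_schreier {c : Ordinal.{0} → ℕ → Ordinal.{0}} (hc : IsApproximating c)
    (β : Ordinal.{0}) (hβ₁ : β < ω₁) : IndexGT (ω ^ β) (schreier c β) := by
  induction β using Ordinal.limitRecOn with
  | zero =>
    rw [schreier_zero]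
    refine .intro (by simp) 0 fun δ hδ n _ => .intro ?_ 0 fun δ' hδ' => ?_
    · rw [mem_sec_singleton]
      simp
    · rw [Ordinal.opow_zero, Order.lt_one_iff] at hδ
      simp [hδ] at hδ'
  | add_one β ih =>
    rw [indexGT_iff]
    refine ⟨empty_mem_schreier hc _ hβ₁, fun δ hδ => ?_⟩
    rw [Ordinal.opow_add, Ordinal.opow_one] at hδ
    obtain ⟨q, hq, r, hr, rfl⟩ := Ordinal.lt_mul_iff.1 hδ
    obtain ⟨k, rfl⟩ := Ordinal.lt_omega0.1 hq
    have hlt : ω ^ β * k + r < ω ^ β * ((k + 1 : ℕ) : Ordinal.{0}) := by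
      push_cast
      rw [mul_add, mul_one]
      gcongr
    obtain ⟨p, hp⟩ := (indexGT_iff.1
      ((ih ((lt_add_one β).trans hβ₁)).succUnions (k + 1))).2 _ hlt
    -- A set with least element at least k + 1 is allowed k + 1 successive members of S_β, and their
    -- index ω^β (k + 1) already exceeds δ.
    refine ⟨max p (k + 1), fun n hn => (hp n (le_of_max_le_left hn)).superset ?_⟩
    intro B hB
    rw [mem_sec_singleton] at hB ⊢
    refine ⟨hB.1, ?_⟩
    obtain ⟨hnB, G, hG, hlt, hGB⟩ := hB
    rw [schreier_add_one]
    refine ⟨k + 1, G, hG, fun j i hi => ?_, hlt, hGB⟩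
    have : i ∈ insert n B := hGB ▸ Finset.mem_biUnion.2 ⟨j, Finset.mem_univ _, hi⟩
    have hkn := le_of_max_le_right hn
    rcases Finset.mem_insert.1 this with rfl | h
    · omega
    · have := hnB i h
      omega
  | limit β hβ ih =>
    rw [indexGT_iff]
    refine ⟨empty_mem_schreier hc _ hβ₁, fun δ hδ => ?_⟩
    obtain ⟨γ, hγ, hδγ⟩ := (Ordinal.lt_opow_of_isSuccLimit Ordinal.omega0_ne_zero hβ).1 hδ
    obtain ⟨n, hn⟩ := hc.exists_lt hβ hβ₁ hγ
    have hnβ := (hc β hβ hβ₁).2.1 n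
    obtain ⟨p, hp⟩ := (indexGT_iff.1 (ih _ hnβ (hnβ.trans hβ₁))).2 δ
      (hδγ.trans_le (Ordinal.opow_le_opow_right Ordinal.omega0_pos hn.le))
    refine ⟨max p n, fun m hm => (hp m (le_of_max_le_left hm)).superset fun B hB => ?_⟩
    rw [mem_sec_singleton] at hB ⊢
    have hnm := le_of_max_le_right hm
    refine ⟨hB.1, ?_⟩
    rw [schreier_limit c β hβ]
    refine ⟨n, hnβ, hB.2, fun i hi => ?_⟩
    rcases Finset.mem_insert.1 hi with rfl | hi
    exacts [hnm, hnm.trans (hB.1 i hi).le]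

/-- A finite ordinal added on the left is absorbed by an infinite one. So blocks supported in
Schreier families of finite order do not lead out of the orders below α. -/
theorem natCast_add_lt {α β : Ordinal.{0}} (hα : Order.IsSuccLimit α) (hβ : β < α) (r : ℕ) :
    (r : Ordinal.{0}) + β < α := by
  rcases lt_or_ge β ω with h | h
  · exact (Ordinal.isPrincipal_add_omega0 (Ordinal.natCast_lt_omega0 r) h).trans_le
      (Ordinal.omega0_le_of_isSuccLimit hα)
  · rwa [Ordinal.add_of_omega0_le (Ordinal.natCast_lt_omega0 r) h]

/-- Families of index below `ω ^ α` are, along a subsequence, eventually contained in Schreier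
families of order below `α`. -/
theorem exists_subsequence_forall_mem_schreier {c : Ordinal.{0} → ℕ → Ordinal.{0}}
    (hc : IsApproximating c) {α : Ordinal.{0}} (hα : Order.IsSuccLimit α) (hα₁ : α < ω₁)
    (𝓖 : ℕ → Set (Finset ℕ)) (h𝓖 : ∀ k, ∃ o < ω ^ α, IndexLE o (𝓖 k)) (L : ℕ) :
    ∃ β : ℕ → Ordinal.{0}, (∀ k, β k < α) ∧ ∃ φ : ℕ → ℕ, StrictMono φ ∧ (∀ i, L ≤ φ i) ∧
      ∀ k, ∀ A : Finset ℕ, (∀ i ∈ A, k ≤ i) → A.image φ ∈ 𝓖 k → A.image φ ∈ schreier c (β k) := by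
  have : ∀ k, ∃ β < α, IndexLE (ω ^ β) (𝓖 k) := by
    intro k
    obtain ⟨o, ho, h⟩ := h𝓖 k
    obtain ⟨β, hβ, hoβ⟩ := (Ordinal.lt_opow_of_isSuccLimit Ordinal.omega0_ne_zero hα).1 ho
    exact ⟨β, hβ, h.mono hoβ.le⟩
  choose β hβ hI using this
  have thin : ∀ n : ℕ, ∀ N : Set ℕ, N.Infinite → ∃ M ⊆ N, M.Infinite ∧
      ∀ k < n, ∀ A ∈ 𝓖 k, (A : Set ℕ) ⊆ M → A ∈ schreier c (β k) := by
    intro n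
    induction n with
    | zero => exact fun N hN => ⟨N, Subset.rfl, hN, by simp⟩
    | succ n ih =>
      intro N hN
      obtain ⟨M, hMN, hM, h⟩ := ih N hN
      obtain ⟨M', hM', hi, h'⟩ := (hI n).exists_thin
        (indexGT_schreier hc (β n) ((hβ n).trans hα₁)) M hM
      refine ⟨M', hM'.trans hMN, hi, fun k hk A hA hAM => ?_⟩
      rcases Nat.lt_succ_iff_lt_or_eq.1 hk with hk | rfl
      exacts [h k hk A hA (hAM.trans hM'), h' A hA hAM]
  obtain ⟨M, hML, hM, hP⟩ := exists_infinite_diagonal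
    (fun n M => ∀ k < n, ∀ A ∈ 𝓖 k, (A : Set ℕ) ⊆ M → A ∈ schreier c (β k))
    (fun n M M' hMM' h k hk A hA hAM => h k hk A hA (hAM.trans hMM'))
    thin (Ici L) (Ici_infinite L)
  have hmono : StrictMono (Nat.nth (· ∈ M)) := Nat.nth_strictMono hM
  have hmem : ∀ i, Nat.nth (· ∈ M) i ∈ M := fun i => Nat.nth_mem_of_infinite hM i
  -- The shift by 2 leaves room for the element of M numbered k + 1: it exceeds k, so it controls
  -- the k-th family, and it precedes φ i for every i ≥ k.
  refine ⟨β, hβ, fun i => Nat.nth (· ∈ M) (i + 2), fun i j hij => hmono (by omega),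
    fun i => hML (hmem _), fun k A hkA hA => ?_⟩
  refine hP _ (hmem (k + 1)) k (Nat.lt_of_succ_le hmono.le_apply) _ hA ?_
  intro j hj
  obtain ⟨i, hi, rfl⟩ := Finset.mem_image.1 (Finset.mem_coe.1 hj)
  have := hkA i hi
  exact ⟨hmem _, hmono (by omega)⟩

/-! ### Unconditional bases -/

section Unconditional

variable {𝕜 : Type*} [RCLike 𝕜] {E : Type*} [NormedAddCommGroup E] [NormedSpace 𝕜 E]

theorem norm_add_sum_ofReal_smul_le {ι : Type*} (u : ι → E) (R : ℝ) (b : ι → ℝ)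
    (hb : ∀ j, 0 ≤ b j ∧ b j ≤ 1) (s : Finset ι) :
    ∀ v : E, (∀ t ⊆ s, ‖v + ∑ j ∈ t, u j‖ ≤ R) → ‖v + ∑ j ∈ s, (b j : 𝕜) • u j‖ ≤ R := by
  classical
  induction s using Finset.induction_on with
  | empty => exact fun v h => by simpa using h ∅ (by simp)
  | insert i s hi ih =>
    intro v h
    have h₁ := ih v fun t ht => h t (ht.trans (Finset.subset_insert _ _))
    have h₂ := ih (v + u i) fun t ht => by
      have := h (insert i t) (Finset.insert_subset_insert _ ht)
      rwa [Finset.sum_insert fun hit => hi (ht hit), ← add_assoc] at this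
    rw [Finset.sum_insert hi]
    set w := ∑ j ∈ s, (b j : 𝕜) • u j
    have hw : v + ((b i : 𝕜) • u i + w) =
        ((1 - b i : ℝ) : 𝕜) • (v + w) + (b i : 𝕜) • (v + u i + w) := by
      push_cast
      module
    obtain ⟨h0, h1⟩ := hb i
    calc ‖v + ((b i : 𝕜) • u i + w)‖ ≤ (1 - b i) * ‖v + w‖ + b i * ‖v + u i + w‖ := by
          rw [hw]
          refine (norm_add_le _ _).trans ?_
          rw [norm_smul, norm_smul, RCLike.norm_ofReal, RCLike.norm_ofReal, abs_of_nonneg h0,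
            abs_of_nonneg (by linarith)]
      _ ≤ (1 - b i) * R + b i * R := by
          gcongr
      _ = R := by ring

/-- Coefficients in [0, 1] give convex combinations of subset sums. The factor 4 comes from the
positive and negative parts of real and imaginary parts. -/
theorem norm_sum_smul_le_of_forall_subset {ι : Type*} (u : ι → E) (R : ℝ) (s : Finset ι)
    (hR : ∀ t ⊆ s, ‖∑ j ∈ t, u j‖ ≤ R) (M : ℝ) (hM : 0 ≤ M) (b : ι → 𝕜) (hb : ∀ j, ‖b j‖ ≤ M) :
    ‖∑ j ∈ s, b j • u j‖ ≤ 4 * M * R := by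
  rcases hM.eq_or_lt with rfl | hM
  · have : ∀ j, b j = 0 := fun j => norm_le_zero_iff.1 (hb j)
    simp [this]
  have real : ∀ f : ι → ℝ, (∀ j, f j ≤ M) → ‖∑ j ∈ s, ((max (f j) 0 : ℝ) : 𝕜) • u j‖ ≤ M * R := by
    intro f hf
    have := norm_add_sum_ofReal_smul_le (𝕜 := 𝕜) u R (fun j => max (f j) 0 / M)
      (fun j => ⟨by positivity, div_le_one_of_le₀ (max_le (hf j) hM.le) hM.le⟩) s 0
      (by simpa using hR)
    rw [zero_add] at this
    have h2 : ∑ j ∈ s, ((max (f j) 0 : ℝ) : 𝕜) • u j =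
        (M : 𝕜) • ∑ j ∈ s, ((max (f j) 0 / M : ℝ) : 𝕜) • u j := by
      rw [Finset.smul_sum]
      refine Finset.sum_congr rfl fun j _ => ?_
      rw [smul_smul, ← RCLike.ofReal_mul, mul_div_cancel₀ _ hM.ne']
    rw [h2, norm_smul, RCLike.norm_ofReal, abs_of_pos hM]
    gcongr
  have hre : ∀ j, |RCLike.re (b j)| ≤ M := fun j => (RCLike.abs_re_le_norm _).trans (hb j)
  have him : ∀ j, |RCLike.im (b j)| ≤ M := fun j => (RCLike.abs_im_le_norm _).trans (hb j)
  have hdec : ∀ x : ℝ, x = max x 0 - max (-x) 0 := fun x => by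
    rcases le_total x 0 with h | h
    · rw [max_eq_right h, max_eq_left (by linarith)]
      ring
    · rw [max_eq_left h, max_eq_right (by linarith)]
      ring
  have h1 := real (fun j => RCLike.re (b j)) fun j => (le_abs_self _).trans (hre j)
  have h2 := real (fun j => -RCLike.re (b j)) fun j => (neg_le_abs _).trans (hre j)
  have h3 := real (fun j => RCLike.im (b j)) fun j => (le_abs_self _).trans (him j)
  have h4 := real (fun j => -RCLike.im (b j)) fun j => (neg_le_abs _).trans (him j)
  set v1 := ∑ j ∈ s, ((max (RCLike.re (b j)) 0 : ℝ) : 𝕜) • u j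
  set v2 := ∑ j ∈ s, ((max (-RCLike.re (b j)) 0 : ℝ) : 𝕜) • u j
  set v3 := ∑ j ∈ s, ((max (RCLike.im (b j)) 0 : ℝ) : 𝕜) • u j
  set v4 := ∑ j ∈ s, ((max (-RCLike.im (b j)) 0 : ℝ) : 𝕜) • u j
  have hsum : ∑ j ∈ s, b j • u j = v1 - v2 + (RCLike.I : 𝕜) • (v3 - v4) := by
    rw [← Finset.sum_sub_distrib, ← Finset.sum_sub_distrib, Finset.smul_sum,
      ← Finset.sum_add_distrib]
    refine Finset.sum_congr rfl fun j _ => ?_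
    rw [← sub_smul, ← sub_smul, ← RCLike.ofReal_sub, ← RCLike.ofReal_sub, ← hdec, ← hdec,
      smul_smul, ← add_smul, mul_comm (RCLike.I : 𝕜), RCLike.re_add_im]
  have hI : ‖(RCLike.I : 𝕜)‖ ≤ 1 := by
    rcases eq_or_ne (RCLike.I : 𝕜) 0 with h | h
    · simp [h]
    · exact (RCLike.norm_I_of_ne_zero h).le
  calc ‖∑ j ∈ s, b j • u j‖ ≤ (‖v1‖ + ‖v2‖) + 1 * (‖v3‖ + ‖v4‖) := by
        rw [hsum]
        refine (norm_add_le _ _).trans (add_le_add (norm_sub_le _ _) ?_)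
        rw [norm_smul]
        exact mul_le_mul hI (norm_sub_le _ _) (norm_nonneg _) zero_le_one
    _ ≤ 4 * M * R := by linarith

theorem proj_sum_smul {β : Type*} [DecidableEq β] {L : SummationFilter β}
    (e : GeneralSchauderBasis β 𝕜 E L) (A B : Finset β) (a : β → 𝕜) :
    e.proj A (∑ i ∈ B, a i • e i) = ∑ i ∈ B ∩ A, a i • e i := by
  simp only [map_sum, map_smul]
  rw [← Finset.sum_filter_add_sum_filter_not B (· ∈ A), ← Finset.filter_mem_eq_inter]
  have h : ∑ i ∈ B with i ∉ A, a i • e.proj A (e i) = 0 := Finset.sum_eq_zero fun i hi => by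
    rw [GeneralSchauderBasis.proj_apply_basis_mem, if_neg (Finset.mem_filter.1 hi).2, smul_zero]
  rw [h, add_zero]
  refine Finset.sum_congr rfl fun i hi => ?_
  rw [GeneralSchauderBasis.proj_apply_basis_mem, if_pos (Finset.mem_filter.1 hi).2]

variable [CompleteSpace E] (e : UnconditionalSchauderBasis ℕ 𝕜 E)

theorem exists_unconditional_constant :
    ∃ K : ℝ, 1 ≤ K ∧ ∀ (a : ℕ → 𝕜) (A B : Finset ℕ), A ⊆ B →
      ‖∑ i ∈ A, a i • e i‖ ≤ K * ‖∑ i ∈ B, a i • e i‖ := by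
  obtain ⟨C, hC⟩ := e.exists_norm_proj_le
  refine ⟨max C 1, le_max_right _ _, fun a A B hAB => ?_⟩
  have := (e.proj A).le_of_opNorm_le ((hC A).trans (le_max_left C 1)) (∑ i ∈ B, a i • e i)
  rwa [proj_sum_smul, Finset.inter_eq_right.2 hAB] at this

/-- Otherwise, for every n, there are n disjoint pieces of norm at least 1 with sum of norm at most
R. By unconditionality their subset sums are uniformly bounded, so the pieces span a uniform copy of
ℓ_∞^n. -/
theorem exists_lt_norm_sum_biUnion (hE : ¬ ContainsC0nUniformly 𝕜 E) (R : ℝ) :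
    ∃ l : ℕ, ∀ (a : ℕ → 𝕜) (s : Finset (Finset ℕ)), s.card = l →
      (∀ F ∈ s, ∀ G ∈ s, F ≠ G → Disjoint F G) → (∀ F ∈ s, 1 ≤ ‖∑ i ∈ F, a i • e i‖) →
      R < ‖∑ i ∈ s.biUnion id, a i • e i‖ := by
  by_contra! hcon
  obtain ⟨K, hK1, hK⟩ := exists_unconditional_constant e
  obtain ⟨C, hC⟩ := e.exists_norm_proj_le
  have hC0 : 0 ≤ C := (norm_nonneg _).trans (hC ∅)
  have hK0 : 0 < K := zero_lt_one.trans_le hK1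
  apply hE
  refine ⟨(C + 1) * (4 * (K * R)), fun n => ?_⟩
  obtain ⟨a, s, hs, hdisj, hge, hle⟩ := hcon n
  let q : s ≃ Fin n := s.equivFinOfCardEq hs
  let F : Fin n → Finset ℕ := fun j => (q.symm j).1
  have hFs : ∀ j, F j ∈ s := fun j => (q.symm j).2
  have hF : ∀ i j, i ≠ j → Disjoint (F i) (F j) := fun i j hij =>
    hdisj _ (hFs i) _ (hFs j) fun h => hij (q.symm.injective (Subtype.ext h))
  let u : Fin n → E := fun j => ∑ i ∈ F j, a i • e i
  have hsub : ∀ t : Finset (Fin n), ‖∑ j ∈ t, u j‖ ≤ K * R := by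
    intro t
    have : ∑ j ∈ t, u j = ∑ i ∈ t.biUnion F, a i • e i :=
      (Finset.sum_biUnion fun i _ j _ hij => hF i j hij).symm
    rw [this]
    refine (hK a _ (s.biUnion id) ?_).trans (by gcongr)
    exact Finset.biUnion_subset.2 fun j _ => Finset.subset_biUnion_of_mem id (hFs j)
  -- The factor C + 1 compensates for the norm of the projections onto single pieces, so that the
  -- lower constant becomes 1.
  let T : (Fin n → 𝕜) →ₗ[𝕜] E := ((C + 1 : ℝ) : 𝕜) • (Fintype.linearCombination 𝕜 u)
  have hT : ∀ b, T b = ((C + 1 : ℝ) : 𝕜) • ∑ j, b j • u j := fun b => by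
    simp [T, Fintype.linearCombination_apply]
  have hTn : ∀ b, ‖T b‖ = (C + 1) * ‖∑ j, b j • u j‖ := fun b => by
    rw [hT, norm_smul, RCLike.norm_ofReal, abs_of_nonneg (by linarith)]
  refine ⟨T, fun b => ⟨?_, ?_⟩⟩
  · rw [hTn]
    refine (pi_norm_le_iff_of_nonneg (by positivity)).2 fun j => ?_
    have hp : e.proj (F j) (∑ i, b i • u i) = b j • u j := by
      rw [map_sum, Finset.sum_eq_single j]
      · rw [map_smul, proj_sum_smul, Finset.inter_self]
      · intro i _ hij
        rw [map_smul, proj_sum_smul, Finset.disjoint_iff_inter_eq_empty.1 (hF i j hij)]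
        simp
      · simp
    have h1 : 1 ≤ ‖u j‖ := hge _ (hFs j)
    calc ‖b j‖ ≤ ‖b j‖ * ‖u j‖ := le_mul_of_one_le_right (norm_nonneg _) h1
      _ = ‖e.proj (F j) (∑ i, b i • u i)‖ := by rw [hp, norm_smul]
      _ ≤ C * ‖∑ i, b i • u i‖ := (e.proj (F j)).le_of_opNorm_le (hC _) _
      _ ≤ (C + 1) * ‖∑ i, b i • u i‖ := by gcongr; linarith
  · rw [hTn]
    have := norm_sum_smul_le_of_forall_subset u (K * R) Finset.univ (fun t _ => hsub t) ‖b‖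
      (norm_nonneg _) b (norm_le_pi_norm b)
    calc (C + 1) * ‖∑ j, b j • u j‖ ≤ (C + 1) * (4 * ‖b‖ * (K * R)) := by gcongr
      _ = _ := by ring

end Unconditional

/-! ### Domination by subsequences -/

theorem exists_le_lt_succ {L : ℕ → ℕ} (h0 : L 0 = 0) (hL : StrictMono L) (i : ℕ) :
    ∃ k, L k ≤ i ∧ i < L (k + 1) := by
  induction i with
  | zero => exact ⟨0, h0.le, (Nat.zero_le _).trans_lt (hL (Nat.lt_succ_self 0))⟩
  | succ i ih =>
    obtain ⟨k, hk, hk'⟩ := ih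
    rcases (Nat.succ_le_of_lt hk').lt_or_eq with h | h
    · exact ⟨k, by omega, h⟩
    · exact ⟨k + 1, h.ge, h.trans_lt (hL (Nat.lt_succ_self _))⟩

/-- Gliding hump: if uniformity fails, counterexamples with growing constants live on successive
intervals, and their subsequences are glued into one subsequence Φ that does not dominate (e_i). -/
theorem exists_uniform_domination {𝕜 : Type*} [RCLike 𝕜] {E : Type*} [NormedAddCommGroup E]
    [NormedSpace 𝕜 E] (e : ℕ → E)
    (he : ∀ φ : ℕ → ℕ, StrictMono φ → Dominates 𝕜 (fun i => e (φ i)) e) :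
    ∃ L s : ℕ, ∀ ψ : ℕ → ℕ, StrictMono ψ → (∀ i, i + s ≤ ψ i) → ∀ a : ℕ →₀ 𝕜,
      (∀ i ∈ a.support, L ≤ i) →
      ‖∑ i ∈ a.support, a i • e i‖ ≤ L * ‖∑ i ∈ a.support, a i • e (ψ i)‖ := by
  by_contra! hcon
  choose ψ hψ hψs a ha hlt using hcon
  -- The next interval starts past the support of the current counterexample; the next shift is the
  -- current ψ at that start, which makes the glued map strictly increasing across the border.
  let next : ℕ × ℕ → ℕ × ℕ := fun p =>
    (max (p.1 + 1) ((a p.1 p.2).support.sup id + 1),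
      ψ p.1 p.2 (max (p.1 + 1) ((a p.1 p.2).support.sup id + 1)))
  let P : ℕ → ℕ × ℕ := fun k => next^[k] (0, 0)
  have hP : ∀ k, P (k + 1) = next (P k) := fun k => Function.iterate_succ_apply' _ _ _
  let L : ℕ → ℕ := fun k => (P k).1
  let Ψ : ℕ → ℕ → ℕ := fun k => ψ (P k).1 (P k).2
  have hL : StrictMono L := strictMono_nat_of_lt_succ fun k => by
    change (P k).1 < (P (k + 1)).1
    rw [hP]
    exact Nat.lt_of_succ_le (le_max_left _ _)
  have hsupp : ∀ k, ∀ i ∈ (a (P k).1 (P k).2).support, i < L (k + 1) := by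
    intro k i hi
    change i < (P (k + 1)).1
    rw [hP]
    exact (Nat.lt_succ_of_le (Finset.le_sup (f := id) hi)).trans_le (le_max_right _ _)
  have hborder : ∀ k, Ψ k (L (k + 1)) ≤ Ψ (k + 1) (L (k + 1)) := by
    intro k
    refine le_trans ?_ (hψs (P (k + 1)).1 (P (k + 1)).2 _)
    have : Ψ k (L (k + 1)) = (P (k + 1)).2 := by
      change ψ (P k).1 (P k).2 (P (k + 1)).1 = _
      rw [hP]
    rw [this]
    omega
  choose κ hκ hκ' using exists_le_lt_succ (L := L) rfl hL
  have huniq : ∀ k i, L k ≤ i → i < L (k + 1) → κ i = k := by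
    intro k i h h'
    have h1 := hL.lt_iff_lt.1 (h.trans_lt (hκ' i))
    have h2 := hL.lt_iff_lt.1 ((hκ i).trans_lt h')
    omega
  let Φ : ℕ → ℕ := fun i => Ψ (κ i) i
  have hΦ : StrictMono Φ := strictMono_nat_of_lt_succ fun i => by
    have hlt : Ψ (κ i) i < Ψ (κ i) (i + 1) := hψ _ _ (Nat.lt_succ_self i)
    change Ψ (κ i) i < Ψ (κ (i + 1)) (i + 1)
    rcases (Nat.succ_le_of_lt (hκ' i)).lt_or_eq with h | h
    · rwa [huniq (κ i) (i + 1) ((hκ i).trans (Nat.le_succ i)) h]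
    · rw [huniq (κ i + 1) (i + 1) h.ge (by rw [← Nat.succ_eq_add_one i, h]; exact hL (by omega))]
      refine hlt.trans_le ?_
      have := hborder (κ i)
      rwa [← h] at this
  obtain ⟨C, -, hC⟩ := he Φ hΦ
  obtain ⟨k, hk⟩ := exists_nat_ge C
  set f := a (P k).1 (P k).2 with hf
  have hsame : ∑ i ∈ f.support, f i • e (Φ i) = ∑ i ∈ f.support, f i • e (Ψ k i) :=
    Finset.sum_congr rfl fun i hi => by
      change f i • e (Ψ (κ i) i) = _
      rw [huniq k i (ha _ _ i hi) (hsupp k i hi)]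
  have h1 := hC f
  rw [hsame] at h1
  have h2 : ((P k).1 : ℝ) * ‖∑ i ∈ f.support, f i • e (Ψ k i)‖ < ‖∑ i ∈ f.support, f i • e i‖ :=
    hlt (P k).1 (P k).2
  have h3 : C ≤ ((P k).1 : ℝ) := hk.trans (by exact_mod_cast hL.le_apply (x := k))
  have h4 := mul_le_mul_of_nonneg_right h3 (norm_nonneg (∑ i ∈ f.support, f i • e (Ψ k i)))
  linarith

/-! ### Peeling off finite sets -/

section Peeling

variable {𝕜 : Type*} [RCLike 𝕜] {E X Y : Type*} [NormedAddCommGroup E] [NormedSpace 𝕜 E]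
  [NormedAddCommGroup X] [NormedSpace 𝕜 X] [NormedAddCommGroup Y] [NormedSpace 𝕜 Y]

theorem sum_filter_smul (e : ℕ → E) (b : ℕ →₀ 𝕜) (p : ℕ → Prop) [DecidablePred p]
    (F : Finset ℕ) : ∑ i ∈ F, (b.filter p) i • e i = ∑ i ∈ F.filter p, b i • e i := by
  rw [Finset.sum_filter]
  refine Finset.sum_congr rfl fun i _ => ?_
  rw [Finsupp.filter_apply]
  split_ifs <;> simp

theorem linearCombination_eq_sum_of_subset (e : ℕ → E) (b : ℕ →₀ 𝕜) {U : Finset ℕ}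
    (h : b.support ⊆ U) : Finsupp.linearCombination 𝕜 e b = ∑ i ∈ U, b i • e i := by
  rw [Finsupp.linearCombination_apply]
  exact Finsupp.sum_of_support_subset b h _ (by simp)

/-- Families `H k` of finite sets and constants `C k` such that the norm of `∑ i ∈ F, a i • e i`
is at most `C k * ‖∑ a i • y i‖` for `F ∈ H k`, such that few disjoint members of `H k` carry large
pieces of a vector, and such that `∑ a i • x i` is small once all pieces over `H k` are small. -/
structure Peeling (𝕜 : Type*) [RCLike 𝕜] {E X Y : Type*} [NormedAddCommGroup E] [NormedSpace 𝕜 E]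
    [NormedAddCommGroup X] [NormedSpace 𝕜 X] [NormedAddCommGroup Y] [NormedSpace 𝕜 Y]
    (e : ℕ → E) (x : ℕ → X) (y : ℕ → Y) where
  H : ℕ → Set (Finset ℕ)
  C : ℕ → ℝ
  ε : ℕ → ℝ
  δ : ℕ → ℝ
  l : ℕ → ℕ
  isLowerSet : ∀ k, IsLowerSet (H k)
  subset_succ : ∀ k, H k ⊆ H (k + 1)
  unions_subset : ∀ k, unions (l k) (H k) ⊆ H (k + 1)
  index : ∀ k, ∃ o, IndexLE o (H k)
  C_pos : ∀ k, 0 < C k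
  ε_pos : ∀ k, 0 < ε k
  tendsto_C : Tendsto C atTop atTop
  tendsto_ε : Tendsto ε atTop (𝓝 0)
  summable_δ : Summable δ
  norm_sum_le : ∀ k (a : ℕ →₀ 𝕜), ∀ F ∈ H k,
    ‖∑ i ∈ F, a i • e i‖ ≤ C k * ‖Finsupp.linearCombination 𝕜 y a‖
  lt_norm_sum : ∀ k (a : ℕ → 𝕜) (s : Finset (Finset ℕ)), s.card = l k →
    (∀ F ∈ s, ∀ G ∈ s, F ≠ G → Disjoint F G) → (∀ F ∈ s, ε k ≤ ‖∑ i ∈ F, a i • e i‖) →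
    C (k + 1) < ‖∑ i ∈ s.biUnion id, a i • e i‖
  norm_le_δ : ∀ k (a : ℕ →₀ 𝕜), (∀ F ∈ H k, ‖∑ i ∈ F, a i • e i‖ ≤ ε k) →
    ‖Finsupp.linearCombination 𝕜 e a‖ ≤ C (k + 2) → ‖Finsupp.linearCombination 𝕜 x a‖ ≤ δ k

namespace Peeling

variable {e : ℕ → E} {x : ℕ → X} {y : ℕ → Y} (P : Peeling 𝕜 e x y)

include P

theorem δ_nonneg (k : ℕ) : 0 ≤ P.δ k := by
  simpa using P.norm_le_δ k 0 (by simp [(P.ε_pos k).le]) (by simp [(P.C_pos (k + 2)).le])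

theorem monotone_H : Monotone P.H := monotone_nat_of_le_succ P.subset_succ

/-- U is the union of a maximal disjoint collection of large pieces over `H j`. Such a collection
has fewer than `l j` members, since the union of `l j` of them would be in `H (j + 1)` and carry
norm above `C (j + 1)`. -/
theorem exists_peel (j : ℕ) (b : ℕ →₀ 𝕜)
    (hb : ∀ k, ∀ F ∈ P.H k, ‖∑ i ∈ F, b i • e i‖ ≤ P.C k) :
    ∃ U ∈ P.H (j + 1), ∀ F ∈ P.H j, ‖∑ i ∈ F, (b.filter (· ∉ U)) i • e i‖ ≤ P.ε j := by
  by_contra! hcon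
  let Q : Finset (Finset ℕ) → Prop := fun s =>
    (∀ F ∈ s, ∀ G ∈ s, F ≠ G → Disjoint F G) ∧
      ∀ F ∈ s, F ∈ P.H j ∧ P.ε j ≤ ‖∑ i ∈ F, b i • e i‖
  have hbd : ∀ s, Q s → s.card < P.l j := by
    intro s hs
    by_contra! hcard
    obtain ⟨t, hts, ht⟩ := Finset.exists_subset_card_eq hcard
    have h1 := P.lt_norm_sum j b t ht (fun F hF G hG => hs.1 F (hts hF) G (hts hG))
      fun F hF => (hs.2 F (hts hF)).2
    exact (hb (j + 1) _ (P.unions_subset j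
      ⟨t, ht.le, fun F hF => (hs.2 F (hts hF)).1, rfl⟩)).not_gt h1
  have hlarge : ∀ n, ∃ s, Q s ∧ n ≤ s.card := by
    intro n
    induction n with
    | zero => exact ⟨∅, ⟨by simp, by simp⟩, by simp⟩
    | succ n ih =>
      obtain ⟨s, hs, hn⟩ := ih
      obtain ⟨F, hF, hFε⟩ := hcon (s.biUnion id) (P.unions_subset j
        ⟨s, (hbd s hs).le, fun F hF => (hs.2 F hF).1, rfl⟩)
      rw [sum_filter_smul] at hFε
      set F' := F.filter (· ∉ s.biUnion id) with hF'
      have hdisj : ∀ G ∈ s, Disjoint F' G := fun G hG =>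
        Finset.disjoint_left.2 fun i hi hiG => (Finset.mem_filter.1 hi).2
          (Finset.mem_biUnion.2 ⟨G, hG, hiG⟩)
      have hnot : F' ∉ s := fun h => by
        have hemp : F' = ∅ := by simpa using hdisj F' h
        rw [hemp, Finset.sum_empty, norm_zero] at hFε
        exact (P.ε_pos j).not_gt hFε
      refine ⟨insert F' s, ⟨?_, ?_⟩, by rw [Finset.card_insert_of_notMem hnot]; omega⟩
      · intro A hA B hB hAB
        rcases Finset.mem_insert.1 hA with rfl | hA
        · rcases Finset.mem_insert.1 hB with rfl | hB
          exacts [absurd rfl hAB, hdisj B hB]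
        · rcases Finset.mem_insert.1 hB with rfl | hB
          exacts [(hdisj A hA).symm, hs.1 A hA B hB hAB]
      · intro A hA
        rcases Finset.mem_insert.1 hA with rfl | hA
        exacts [⟨P.isLowerSet j (Finset.filter_subset _ _) hF, hFε.le⟩, hs.2 A hA]
  obtain ⟨s, hs, hn⟩ := hlarge (P.l j)
  exact (hbd s hs).not_ge hn

/-- Peel at level j + 1. The part on U ∈ `H (j + 2)` has norm at most `C (j + 2)` and inherits small
pieces over `H j`, so it costs `δ j`; the rest has small pieces over `H (j + 1)` and the argument
repeats. -/
theorem norm_le_sum_range (m : ℕ) : ∀ (j : ℕ) (b : ℕ →₀ 𝕜),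
    (∀ k, ∀ F ∈ P.H k, ‖∑ i ∈ F, b i • e i‖ ≤ P.C k) →
    (∀ F ∈ P.H j, ‖∑ i ∈ F, b i • e i‖ ≤ P.ε j) →
    (∀ U : Finset ℕ, ‖∑ i ∈ U, b i • e i‖ ≤ P.C (j + m + 2)) →
    ‖Finsupp.linearCombination 𝕜 x b‖ ≤ ∑ i ∈ Finset.range (m + 1), P.δ (j + i) := by
  induction m with
  | zero =>
    intro j b _ hε hC
    simp only [zero_add, Finset.range_one, Finset.sum_singleton, add_zero]
    refine P.norm_le_δ j b hε ?_
    rw [linearCombination_eq_sum_of_subset e b Subset.rfl]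
    exact hC _
  | succ m ih =>
    intro j b hb hε hC
    obtain ⟨U, hU, hUε⟩ := P.exists_peel (j + 1) b hb
    have h1 : ‖Finsupp.linearCombination 𝕜 x (b.filter (· ∈ U))‖ ≤ P.δ j := by
      refine P.norm_le_δ j _ (fun F hF => ?_) ?_
      · rw [sum_filter_smul]
        exact hε _ (P.isLowerSet j (Finset.filter_subset _ _) hF)
      · rw [linearCombination_eq_sum_of_subset e _ (U := U)
          (by rw [Finsupp.support_filter]; exact fun i hi => (Finset.mem_filter.1 hi).2),
          sum_filter_smul, Finset.filter_true_of_mem fun i hi => hi]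
        exact hb (j + 2) U hU
    have h2 := ih (j + 1) (b.filter (· ∉ U))
      (fun k F hF => by
        rw [sum_filter_smul]
        exact hb k _ (P.isLowerSet k (Finset.filter_subset _ _) hF)) hUε
      (fun V => by
        rw [sum_filter_smul, show j + 1 + m + 2 = j + (m + 1) + 2 by omega]
        exact hC _)
    have hdec : b = b.filter (· ∈ U) + b.filter (· ∉ U) := (Finsupp.filter_add_filter_not b _).symm
    calc ‖Finsupp.linearCombination 𝕜 x b‖
        = ‖Finsupp.linearCombination 𝕜 x (b.filter (· ∈ U)) +
            Finsupp.linearCombination 𝕜 x (b.filter (· ∉ U))‖ := by rw [← map_add, ← hdec]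
      _ ≤ P.δ j + ∑ i ∈ Finset.range (m + 1), P.δ (j + 1 + i) := (norm_add_le _ _).trans
          (add_le_add h1 h2)
      _ = ∑ i ∈ Finset.range (m + 1 + 1), P.δ (j + i) := by
          rw [Finset.sum_range_succ' _ (m + 1), add_zero, add_comm (P.δ j)]
          simp only [add_assoc, add_comm 1]

theorem norm_le_tsum (j : ℕ) (b : ℕ →₀ 𝕜) (hb : ‖Finsupp.linearCombination 𝕜 y b‖ ≤ 1)
    (hε : ∀ F ∈ P.H j, ‖∑ i ∈ F, b i • e i‖ ≤ P.ε j) :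
    ‖Finsupp.linearCombination 𝕜 x b‖ ≤ ∑' i, P.δ (i + j) := by
  have hsum : ∀ U : Finset ℕ, ‖∑ i ∈ U, b i • e i‖ ≤ ∑ i ∈ b.support, ‖b i • e i‖ := by
    intro U
    refine (_root_.norm_sum_le _ _).trans ?_
    rw [← Finset.sum_filter_ne_zero]
    refine Finset.sum_le_sum_of_subset_of_nonneg (fun i hi => ?_) fun _ _ _ => norm_nonneg _
    rw [Finsupp.mem_support_iff]
    intro h
    simp [h] at hi
  -- The support is finite, so the constants `C` eventually exceed the norm of every piece, and the
  -- peeling can stop there.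
  obtain ⟨m, hm, hmj⟩ := ((P.tendsto_C.eventually_ge_atTop (∑ i ∈ b.support, ‖b i • e i‖)).and
    (eventually_ge_atTop (j + 2))).exists
  obtain ⟨m, rfl⟩ := Nat.exists_eq_add_of_le hmj
  have h := P.norm_le_sum_range m j b (fun k F hF => (P.norm_sum_le k b F hF).trans
    (mul_le_of_le_one_right (P.C_pos k).le hb)) hε fun U => (hsum U).trans
      (by rwa [show j + m + 2 = j + 2 + m by omega])
  refine h.trans ?_
  simp_rw [add_comm j]
  exact ((summable_nat_add_iff j).2 P.summable_δ).sum_le_tsum _ fun i _ => P.δ_nonneg _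

theorem exists_norm_le : ∃ K : ℝ, ∀ b : ℕ →₀ 𝕜,
    ‖Finsupp.linearCombination 𝕜 x b‖ ≤ K * ‖Finsupp.linearCombination 𝕜 y b‖ := by
  -- after rescaling, all pieces over `H 0` are small
  have hc0 : 0 < min 1 (P.ε 0 / P.C 0) := lt_min one_pos (div_pos (P.ε_pos 0) (P.C_pos 0))
  set r := min 1 (P.ε 0 / P.C 0)
  have key : ∀ b : ℕ →₀ 𝕜, ‖Finsupp.linearCombination 𝕜 y b‖ ≤ r →
      ‖Finsupp.linearCombination 𝕜 x b‖ ≤ ∑' i, P.δ (i + 0) := fun b hb =>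
    P.norm_le_tsum 0 b (hb.trans (min_le_left _ _)) fun F hF =>
      (P.norm_sum_le 0 b F hF).trans <| by
        rw [mul_comm]
        exact (le_div_iff₀ (P.C_pos 0)).1 (hb.trans (min_le_right _ _))
  set S := ∑' i, P.δ (i + 0)
  refine ⟨S / r, fun b => ?_⟩
  -- Linear independence of y is not assumed: if the combination vanishes, the bound for all
  -- multiples of b forces the image to vanish.
  rcases eq_or_ne ‖Finsupp.linearCombination 𝕜 y b‖ 0 with h | h
  · have hall : ∀ n : ℕ, n * ‖Finsupp.linearCombination 𝕜 x b‖ ≤ S := fun n => by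
      have := key ((n : 𝕜) • b) (by rw [map_smul, norm_smul, h, mul_zero]; exact hc0.le)
      rwa [map_smul, norm_smul, RCLike.norm_natCast] at this
    rw [h, mul_zero]
    by_contra! hpos
    obtain ⟨n, hn⟩ := exists_nat_gt (S / ‖Finsupp.linearCombination 𝕜 x b‖)
    exact (hall n).not_gt ((div_lt_iff₀ hpos).1 hn)
  · have hpos : 0 < ‖Finsupp.linearCombination 𝕜 y b‖ := lt_of_le_of_ne (norm_nonneg _) h.symm
    set ρ := ‖Finsupp.linearCombination 𝕜 y b‖
    have := key (((r / ρ : ℝ) : 𝕜) • b) (by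
      rw [map_smul, norm_smul, RCLike.norm_ofReal, abs_of_pos (by positivity)]
      change r / ρ * ρ ≤ r
      rw [div_mul_cancel₀ _ h])
    rw [map_smul, norm_smul, RCLike.norm_ofReal, abs_of_pos (by positivity)] at this
    rw [div_mul_eq_mul_div, le_div_iff₀ hc0]
    rw [div_mul_eq_mul_div, div_le_iff₀ hpos] at this
    linarith

/-- Add up m successive normalized vectors. Each supplies a new disjoint piece over `H k` of norm at
least η, yet pieces over 𝓖 stay bounded: if F ∈ 𝓖 meets the first vector at n, that vector
contributes at most `C k`, and the rest of F lies in the section at n, where the later vectors were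
chosen small. -/
theorem exists_sum_blocks {k : ℕ} {η : ℝ} (hη : 0 < η) (d : Seminorm 𝕜 (ℕ →₀ 𝕜))
    (hbig : ∀ a : ℕ →₀ 𝕜, ‖Finsupp.linearCombination 𝕜 y a‖ = 1 → d a ≤ η →
      ∃ F ∈ P.H k, η < ‖∑ i ∈ F, a i • e i‖)
    {𝓖 : Set (Finset ℕ)} (h𝓖 : IsLowerSet 𝓖) (h𝓖k : 𝓖 ⊆ P.H k) (p : ℕ)
    (ih : ∀ N : ℕ, ∀ ζ > 0, ∃ a : ℕ →₀ 𝕜, (∀ i ∈ a.support, N ≤ i) ∧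
      ‖Finsupp.linearCombination 𝕜 y a‖ = 1 ∧ d a ≤ ζ ∧
      ∀ n, p ≤ n → n < N → ∀ F ∈ sec 𝓖 {n}, ‖∑ i ∈ F, a i • e i‖ ≤ ζ) (m : ℕ) :
    ∀ N : ℕ, ∀ θ > 0, p ≤ N → θ ≤ 1 → θ ≤ η → ∃ b : ℕ →₀ 𝕜, (∀ i ∈ b.support, N ≤ i) ∧
      d b ≤ θ ∧ (∀ n, p ≤ n → n < N → ∀ F ∈ sec 𝓖 {n}, ‖∑ i ∈ F, b i • e i‖ ≤ θ) ∧
      (∀ F ∈ 𝓖, ‖∑ i ∈ F, b i • e i‖ ≤ P.C k + 1) ∧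
      ∃ s : Finset (Finset ℕ), s.card = m ∧ (∀ F ∈ s, ∀ G ∈ s, F ≠ G → Disjoint F G) ∧
        ∀ F ∈ s, F ∈ P.H k ∧ F ⊆ b.support ∧ η ≤ ‖∑ i ∈ F, b i • e i‖ := by
  induction m with
  | zero =>
    intro N θ hθ _ _ _
    exact ⟨0, by simp, by simpa using hθ.le, fun _ _ _ _ _ => by simpa using hθ.le,
      fun _ _ => by simpa using (add_pos (P.C_pos k) one_pos).le, ∅, by simp, by simp, by simp⟩
  | succ m ihm =>
    intro N θ hθ hpN hθ1 hθη
    obtain ⟨a, haN, hay, had, hasec⟩ := ih N (θ / 2) (by positivity)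
    set N' := max N (a.support.sup id + 1) with hN'
    have haN' : ∀ i ∈ a.support, i < N' := fun i hi =>
      (Nat.lt_succ_of_le (Finset.le_sup (f := id) hi)).trans_le (le_max_right _ _)
    obtain ⟨r, hrN, hrd, hrsec, hrG, s, hs, hsd, hsF⟩ := ihm N' (θ / 2) (by positivity)
      (hpN.trans (le_max_left _ _)) (by linarith) (by linarith)
    have hdisj : Disjoint a.support r.support := Finset.disjoint_left.2 fun i hi hi' =>
      (haN' i hi).not_ge (hrN i hi')
    have hsupp : (a + r).support = a.support ∪ r.support := Finsupp.support_add_eq hdisj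
    have hadd : ∀ F : Finset ℕ, ∑ i ∈ F, (a + r) i • e i =
        ∑ i ∈ F, a i • e i + ∑ i ∈ F, r i • e i := fun F => by
      simp [add_smul, Finset.sum_add_distrib]
    have hzero : ∀ (f : ℕ →₀ 𝕜) (F : Finset ℕ), Disjoint F f.support →
        ∑ i ∈ F, f i • e i = 0 := fun f F h => Finset.sum_eq_zero fun i hi => by
      rw [Finsupp.notMem_support_iff.1 (Finset.disjoint_left.1 h hi), zero_smul]
    obtain ⟨F₀, hF₀, hF₀η⟩ := hbig a hay (by linarith)
    have hF₁ : ∑ i ∈ F₀ ∩ a.support, a i • e i = ∑ i ∈ F₀, a i • e i := by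
      refine Finset.sum_subset Finset.inter_subset_left fun i hi hi' => ?_
      have : i ∉ a.support := fun h => hi' (Finset.mem_inter.2 ⟨hi, h⟩)
      rw [Finsupp.notMem_support_iff.1 this, zero_smul]
    have hF₁r : Disjoint (F₀ ∩ a.support) r.support :=
      hdisj.mono_left Finset.inter_subset_right
    have hnot : F₀ ∩ a.support ∉ s := fun h => by
      have hemp : F₀ ∩ a.support = ∅ := by
        simpa using hF₁r.mono_right (hsF _ h).2.1
      rw [← hF₁, hemp, Finset.sum_empty, norm_zero] at hF₀η
      exact hη.not_gt hF₀η
    refine ⟨a + r, ?_, ?_, ?_, ?_, insert (F₀ ∩ a.support) s, ?_, ?_, ?_⟩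
    · intro i hi
      rw [hsupp] at hi
      rcases Finset.mem_union.1 hi with hi | hi
      exacts [haN i hi, (le_max_left _ _).trans (hrN i hi)]
    · exact (map_add_le_add d a r).trans (by linarith)
    · intro n hpn hnN F hF
      rw [hadd]
      have h1 := hasec n hpn hnN F hF
      have h2 := hrsec n hpn (hnN.trans_le (le_max_left _ _)) F hF
      exact (norm_add_le _ _).trans (by linarith)
    · intro F hF
      rw [hadd]
      by_cases hFa : Disjoint F a.support
      · rw [hzero a F hFa, zero_add]
        exact hrG F hF
      · obtain ⟨n, hnF, hna⟩ := Finset.not_disjoint_iff.1 hFa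
        have h1 : ‖∑ i ∈ F, a i • e i‖ ≤ P.C k := by
          simpa [hay] using P.norm_sum_le k a F (h𝓖k hF)
        have h2 := hrsec n (hpN.trans (haN n hna)) (haN' n hna) _ (filter_gt_mem_sec h𝓖 hF hnF)
        have h3 : ∑ i ∈ F with n < i, r i • e i = ∑ i ∈ F, r i • e i := by
          refine Finset.sum_subset (Finset.filter_subset _ _) fun i hi hi' => ?_
          have : i ∉ r.support := fun h => hi' (Finset.mem_filter.2
            ⟨hi, (haN' n hna).trans_le (hrN i h)⟩)
          rw [Finsupp.notMem_support_iff.1 this, zero_smul]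
        rw [h3] at h2
        exact (norm_add_le _ _).trans (by linarith)
    · rw [Finset.card_insert_of_notMem hnot, hs]
    · have hd : ∀ G ∈ s, Disjoint (F₀ ∩ a.support) G := fun G hG =>
        hF₁r.mono_right (hsF G hG).2.1
      intro A hA B hB hAB
      rcases Finset.mem_insert.1 hA with rfl | hA
      · rcases Finset.mem_insert.1 hB with rfl | hB
        exacts [absurd rfl hAB, hd B hB]
      · rcases Finset.mem_insert.1 hB with rfl | hB
        exacts [(hd A hA).symm, hsd A hA B hB hAB]
    · intro A hA
      rw [hadd, hsupp]
      rcases Finset.mem_insert.1 hA with rfl | hA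
      · refine ⟨P.isLowerSet k Finset.inter_subset_left hF₀,
          Finset.inter_subset_right.trans Finset.subset_union_left, ?_⟩
        rw [hF₁, hzero r _ hF₁r, add_zero]
        exact hF₀η.le
      · obtain ⟨h1, h2, h3⟩ := hsF A hA
        refine ⟨h1, h2.trans Finset.subset_union_right, ?_⟩
        rwa [hzero a A (hdisj.symm.mono_left h2), zero_add]

/-- Finitely many sections of 𝓖 have smaller index, so induction supplies the vectors summed in
`exists_sum_blocks`. The sum has bounded pieces over 𝓖 but many large disjoint pieces over `H k`,
hence a huge norm; normalizing makes the pieces over 𝓖 small. -/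
theorem exists_small_of_indexLE {k : ℕ} {η : ℝ} (hη : 0 < η) (d : Seminorm 𝕜 (ℕ →₀ 𝕜))
    (hd : ∀ N : ℕ, ∀ ζ > 0, ∃ a : ℕ →₀ 𝕜, (∀ i ∈ a.support, N ≤ i) ∧
      ‖Finsupp.linearCombination 𝕜 y a‖ = 1 ∧ d a ≤ ζ)
    (hbig : ∀ a : ℕ →₀ 𝕜, ‖Finsupp.linearCombination 𝕜 y a‖ = 1 → d a ≤ η →
      ∃ F ∈ P.H k, η < ‖∑ i ∈ F, a i • e i‖) (o : Ordinal.{0}) :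
    ∀ 𝓖 : Set (Finset ℕ), IsLowerSet 𝓖 → 𝓖 ⊆ P.H k → IndexLE o 𝓖 → ∀ N : ℕ, ∀ ζ > 0,
      ∃ a : ℕ →₀ 𝕜, (∀ i ∈ a.support, N ≤ i) ∧ ‖Finsupp.linearCombination 𝕜 y a‖ = 1 ∧
        d a ≤ ζ ∧ ∀ F ∈ 𝓖, ‖∑ i ∈ F, a i • e i‖ ≤ ζ := by
  induction o using WellFoundedLT.induction with | _ o ih
  intro 𝓖 h𝓖 h𝓖k hI N ζ hζ
  cases hI with
  | empty =>
    obtain ⟨a, h1, h2, h3⟩ := hd N ζ hζ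
    exact ⟨a, h1, h2, h3, by simp⟩
  | @step _ δ _ p hδ h =>
    have hsec : ∀ N : ℕ, ∀ ζ > 0, ∃ a : ℕ →₀ 𝕜, (∀ i ∈ a.support, N ≤ i) ∧
        ‖Finsupp.linearCombination 𝕜 y a‖ = 1 ∧ d a ≤ ζ ∧
        ∀ n, p ≤ n → n < N → ∀ F ∈ sec 𝓖 {n}, ‖∑ i ∈ F, a i • e i‖ ≤ ζ := by
      intro N ζ hζ
      obtain ⟨a, h1, h2, h3, h4⟩ := ih δ hδ (⋃ n ∈ Finset.Ico p N, sec 𝓖 {n})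
        (isLowerSet_iUnion₂ fun n _ => isLowerSet_sec h𝓖 _)
        (iUnion₂_subset fun n _ F hF => h𝓖k (h𝓖 Finset.subset_union_right hF.2))
        (IndexLE.biUnion _ fun n hn => h n (Finset.mem_Ico.1 hn).1) N ζ hζ
      exact ⟨a, h1, h2, h3, fun n hpn hnN F hF => h4 F
        (mem_iUnion₂.2 ⟨n, Finset.mem_Ico.2 ⟨hpn, hnN⟩, hF⟩)⟩
    have hC1 : 0 < P.C k + 1 := add_pos (P.C_pos k) one_pos
    -- With `l k'` pieces of norm at least η, rescaled by `ε k' / η`, the sum has norm ρ > `η / ε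
    -- k'`; this k' makes `(C k + 1) / ρ` at most ζ.
    obtain ⟨k', hk'ε, hkk'⟩ := ((P.tendsto_ε.eventually_lt_const
      (show 0 < ζ * η / (P.C k + 1) by positivity)).and (eventually_ge_atTop k)).exists
    have hε := P.ε_pos k'
    obtain ⟨b, hbN, hbd, -, hbG, s, hs, hsd, hsF⟩ := P.exists_sum_blocks hη d hbig h𝓖 h𝓖k p hsec
      (P.l k') (max N p) (min 1 η) (lt_min one_pos hη) (le_max_right _ _) (min_le_left _ _)
      (min_le_right _ _)
    set ρ := ‖Finsupp.linearCombination 𝕜 y b‖ with hρ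
    have hρη : η / P.ε k' < ρ := by
      have hsc : ∀ F : Finset ℕ, ‖∑ i ∈ F, (((P.ε k' / η : ℝ) : 𝕜) • b) i • e i‖ =
          P.ε k' / η * ‖∑ i ∈ F, b i • e i‖ := fun F => by
        simp only [Finsupp.smul_apply, smul_assoc]
        rw [← Finset.smul_sum, norm_smul, RCLike.norm_ofReal, abs_of_pos (by positivity)]
      have h1 := P.lt_norm_sum k' (((P.ε k' / η : ℝ) : 𝕜) • b) s hs hsd fun F hF => by
        have := (hsF F hF).2.2
        refine le_of_le_of_eq ?_ (hsc F).symm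
        calc P.ε k' = P.ε k' / η * η := by field_simp
          _ ≤ _ := by gcongr
      have h2 := P.norm_sum_le (k' + 1) (((P.ε k' / η : ℝ) : 𝕜) • b) (s.biUnion id)
        (P.unions_subset k' ⟨s, hs.le, fun F hF => P.monotone_H hkk' (hsF F hF).1, rfl⟩)
      rw [map_smul, norm_smul, RCLike.norm_ofReal, abs_of_pos (by positivity)] at h2
      have h3 := h1.trans_le h2
      have h4 : 1 < P.ε k' / η * ρ := by
        by_contra! hle
        exact (mul_le_of_le_one_right (P.C_pos (k' + 1)).le hle).not_gt h3
      rw [div_lt_iff₀ hε]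
      rw [div_mul_eq_mul_div, lt_div_iff₀ hη] at h4
      linarith
    have hρ0 : 0 < ρ := (by positivity : 0 < η / P.ε k').trans hρη
    have hζρ : (P.C k + 1) * ρ⁻¹ ≤ ζ := by
      rw [← div_eq_mul_inv, div_le_iff₀ hρ0]
      rw [lt_div_iff₀ hC1] at hk'ε
      rw [div_lt_iff₀ hε] at hρη
      by_contra! hlt
      have := mul_lt_mul_of_pos_right hlt hε
      nlinarith
    have hnorm : ‖((ρ⁻¹ : ℝ) : 𝕜)‖ = ρ⁻¹ := by
      rw [RCLike.norm_ofReal, abs_of_pos (by positivity)]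
    refine ⟨((ρ⁻¹ : ℝ) : 𝕜) • b, ?_, ?_, ?_, ?_⟩
    · exact fun i hi => (le_max_left _ _).trans (hbN i (Finsupp.support_smul hi))
    · rw [map_smul, norm_smul, hnorm, ← hρ, inv_mul_cancel₀ hρ0.ne']
    · rw [map_smul_eq_mul, hnorm]
      have : d b ≤ P.C k + 1 := hbd.trans ((min_le_left _ _).trans (by
        have := P.C_pos k
        linarith))
      calc ρ⁻¹ * d b ≤ ρ⁻¹ * (P.C k + 1) := by gcongr
        _ ≤ ζ := by rwa [mul_comm]
    · intro F hF
      simp only [Finsupp.smul_apply, smul_assoc]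
      rw [← Finset.smul_sum, norm_smul, hnorm]
      calc ρ⁻¹ * ‖∑ i ∈ F, b i • e i‖ ≤ ρ⁻¹ * (P.C k + 1) := by
            gcongr
            exact hbG F hF
        _ ≤ ζ := by rwa [mul_comm]

theorem exists_small (d : Seminorm 𝕜 (ℕ →₀ 𝕜))
    (hd : ∀ N : ℕ, ∀ ζ > 0, ∃ a : ℕ →₀ 𝕜, (∀ i ∈ a.support, N ≤ i) ∧
      ‖Finsupp.linearCombination 𝕜 y a‖ = 1 ∧ d a ≤ ζ) (k : ℕ) {η : ℝ} (hη : 0 < η) :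
    ∃ a : ℕ →₀ 𝕜, ‖Finsupp.linearCombination 𝕜 y a‖ = 1 ∧ d a ≤ η ∧
      ∀ F ∈ P.H k, ‖∑ i ∈ F, a i • e i‖ ≤ η := by
  by_contra! hbig
  obtain ⟨o, ho⟩ := P.index k
  obtain ⟨a, -, h1, h2, h3⟩ := P.exists_small_of_indexLE hη d hd hbig o _ (P.isLowerSet k)
    Subset.rfl ho 0 η hη
  obtain ⟨F, hF, hlt⟩ := hbig a h1 h2
  exact (h3 F hF).not_gt hlt

theorem exists_norm_image_le (d : Seminorm 𝕜 (ℕ →₀ 𝕜))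
    (hd : ∀ N : ℕ, ∀ ζ > 0, ∃ a : ℕ →₀ 𝕜, (∀ i ∈ a.support, N ≤ i) ∧
      ‖Finsupp.linearCombination 𝕜 y a‖ = 1 ∧ d a ≤ ζ) {η : ℝ} (hη : 0 < η) :
    ∃ a : ℕ →₀ 𝕜, ‖Finsupp.linearCombination 𝕜 y a‖ = 1 ∧ d a ≤ η ∧
      ‖Finsupp.linearCombination 𝕜 x a‖ ≤ η := by
  obtain ⟨j, hj⟩ := ((tendsto_sum_nat_add P.δ).eventually_lt_const hη).exists
  obtain ⟨a, h1, h2, h3⟩ := P.exists_small d hd j (lt_min hη (P.ε_pos j))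
  exact ⟨a, h1, h2.trans (min_le_left _ _), (P.norm_le_tsum j a h1.le fun F hF =>
    (h3 F hF).trans (min_le_right _ _)).trans hj.le⟩

end Peeling

end Peeling

/-! ### The operator defined by a peeling -/

section Operator

variable {𝕜 : Type*} [RCLike 𝕜] {E X : Type*} [NormedAddCommGroup E] [NormedSpace 𝕜 E]
  [NormedAddCommGroup X] [NormedSpace 𝕜 X]

/-- The members of a sequence as elements of its closed span. -/
def toClosedSpan (𝕜 : Type*) [RCLike 𝕜] {X : Type*} [NormedAddCommGroup X] [NormedSpace 𝕜 X]
    (y : ℕ → X) (i : ℕ) : closedSpan 𝕜 y :=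
  ⟨y i, Submodule.le_topologicalClosure _ (Submodule.subset_span (mem_range_self i))⟩

theorem coe_linearCombination_toClosedSpan (y : ℕ → X) (a : ℕ →₀ 𝕜) :
    (Finsupp.linearCombination 𝕜 (toClosedSpan 𝕜 y) a : X) = Finsupp.linearCombination 𝕜 y a := by
  simp [Finsupp.linearCombination_apply, Finsupp.sum, toClosedSpan]

theorem denseRange_linearCombination_toClosedSpan (y : ℕ → X) :
    DenseRange (Finsupp.linearCombination 𝕜 (toClosedSpan 𝕜 y)) := by
  intro z
  rw [Metric.mem_closure_iff]
  intro ε hε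
  have hz : (z : X) ∈ closure (Submodule.span 𝕜 (range y) : Set X) := by
    rw [← Submodule.topologicalClosure_coe]
    exact z.2
  obtain ⟨v, hv, hzv⟩ := Metric.mem_closure_iff.1 hz ε hε
  obtain ⟨a, rfl⟩ := Finsupp.mem_span_range_iff_exists_finsupp.1 hv
  refine ⟨_, ⟨a, rfl⟩, ?_⟩
  rw [Subtype.dist_eq, coe_linearCombination_toClosedSpan]
  exact hzv

/-- An infinite-dimensional subspace contains, up to small perturbations, normalized combinations
of the tails of the sequence. -/
theorem exists_combination_near {y : ℕ → X} (Z : Submodule 𝕜 (closedSpan 𝕜 y))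
    (hZ : ¬ FiniteDimensional 𝕜 Z) (N : ℕ) (Q : X →L[𝕜] X)
    (hQ : FiniteDimensional 𝕜 Q.toLinearMap.range) (hQ₁ : ∀ i < N, Q (y i) = y i)
    (hQ₀ : ∀ i, N ≤ i → Q (y i) = 0) {ζ : ℝ} (hζ : 0 < ζ) :
    ∃ a : ℕ →₀ 𝕜, (∀ i ∈ a.support, N ≤ i) ∧ ‖Finsupp.linearCombination 𝕜 y a‖ = 1 ∧
      ‖Z.mkQ (Finsupp.linearCombination 𝕜 (toClosedSpan 𝕜 y) a)‖ ≤ ζ := by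
  -- Q has finite rank and cannot be injective on Z.
  obtain ⟨z, hzZ, hQz, hz1⟩ : ∃ z ∈ Z, Q z = 0 ∧ ‖z‖ = 1 := by
    by_contra! hcon
    refine hZ ?_
    let f : Z →ₗ[𝕜] Q.toLinearMap.range :=
      Q.toLinearMap.rangeRestrict ∘ₗ (closedSpan 𝕜 y).subtype ∘ₗ Z.subtype
    refine FiniteDimensional.of_injective f ((injective_iff_map_eq_zero f).2 fun z hz => ?_)
    by_contra hne
    have hn : ‖(z : closedSpan 𝕜 y)‖ ≠ 0 := by simpa using hne
    refine hcon (((‖(z : closedSpan 𝕜 y)‖⁻¹ : ℝ) : 𝕜) • (z : closedSpan 𝕜 y))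
      (Z.smul_mem _ z.2) ?_ ?_
    · have : Q ((z : closedSpan 𝕜 y) : X) = 0 := congrArg Subtype.val hz
      simp [this]
    · rw [norm_smul, RCLike.norm_ofReal, abs_of_nonneg (by positivity), inv_mul_cancel₀ hn]
  set τ := min (1 / 2) (ζ / 2) with hτ
  have hτ0 : 0 < τ := lt_min (by norm_num) (by positivity)
  have hQ1 : 0 < 1 + ‖Q‖ := by positivity
  obtain ⟨_, ⟨a, rfl⟩, ha⟩ := Metric.mem_closure_iff.1
    (denseRange_linearCombination_toClosedSpan (𝕜 := 𝕜) y z) (τ / (1 + ‖Q‖)) (by positivity)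
  rw [dist_comm, dist_eq_norm] at ha
  set v := Finsupp.linearCombination 𝕜 (toClosedSpan 𝕜 y) a with hv
  set a₁ := a.filter (fun i => ¬ i < N) with ha₁
  set a₀ := a.filter (fun i => i < N) with ha₀
  have hdec : a₀ + a₁ = a := Finsupp.filter_add_filter_not a _
  -- Q fixes the head of v and kills both its tail and z. So the head is small and may be discarded.
  have hQ0 : Finsupp.linearCombination 𝕜 y a₀ = Q ((v - z : closedSpan 𝕜 y) : X) := by
    have h1 : Q (Finsupp.linearCombination 𝕜 y a₁) = 0 := by
      rw [Finsupp.linearCombination_apply, Finsupp.sum, map_sum]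
      refine Finset.sum_eq_zero fun i hi => ?_
      rw [map_smul, hQ₀ i (not_lt.1 ?_), smul_zero]
      rw [ha₁, Finsupp.support_filter] at hi
      exact (Finset.mem_filter.1 hi).2
    have h2 : Q (Finsupp.linearCombination 𝕜 y a₀) = Finsupp.linearCombination 𝕜 y a₀ := by
      rw [Finsupp.linearCombination_apply, Finsupp.sum, map_sum]
      refine Finset.sum_congr rfl fun i hi => ?_
      rw [map_smul, hQ₁ i]
      rw [ha₀, Finsupp.support_filter] at hi
      exact (Finset.mem_filter.1 hi).2
    rw [Submodule.coe_sub, map_sub, hQz, sub_zero, hv, coe_linearCombination_toClosedSpan, ← hdec,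
      map_add, map_add, h1, h2, add_zero]
  set w := Finsupp.linearCombination 𝕜 (toClosedSpan 𝕜 y) a₁ with hw
  have hwz : ‖w - z‖ ≤ τ := by
    have : ((w - z : closedSpan 𝕜 y) : X) = ((v - z : closedSpan 𝕜 y) : X) -
        Q ((v - z : closedSpan 𝕜 y) : X) := by
      rw [← hQ0, Submodule.coe_sub, Submodule.coe_sub, hv, hw, coe_linearCombination_toClosedSpan,
        coe_linearCombination_toClosedSpan]
      rw [show Finsupp.linearCombination 𝕜 y a = Finsupp.linearCombination 𝕜 y a₀ +
        Finsupp.linearCombination 𝕜 y a₁ by rw [← map_add, hdec]]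
      abel
    calc ‖w - z‖ = ‖((v - z : closedSpan 𝕜 y) : X) - Q ((v - z : closedSpan 𝕜 y) : X)‖ := by
          rw [← this]; rfl
      _ ≤ ‖v - z‖ + ‖Q‖ * ‖v - z‖ := (norm_sub_le _ _).trans (add_le_add le_rfl (Q.le_opNorm _))
      _ = (1 + ‖Q‖) * ‖v - z‖ := by ring
      _ ≤ (1 + ‖Q‖) * (τ / (1 + ‖Q‖)) := by gcongr
      _ = τ := by field_simp
  have hwn : 1 / 2 ≤ ‖w‖ := by
    have h1 := norm_sub_norm_le z w
    rw [norm_sub_rev] at h1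
    have h2 : τ ≤ 1 / 2 := min_le_left _ _
    linarith
  have hw0 : 0 < ‖w‖ := by linarith
  have hnorm : ‖((‖w‖⁻¹ : ℝ) : 𝕜)‖ = ‖w‖⁻¹ := by
    rw [RCLike.norm_ofReal, abs_of_pos (by positivity)]
  refine ⟨((‖w‖⁻¹ : ℝ) : 𝕜) • a₁, fun i hi => ?_, ?_, ?_⟩
  · have := Finsupp.support_smul hi
    rw [ha₁, Finsupp.support_filter] at this
    exact not_lt.1 (Finset.mem_filter.1 this).2
  · rw [map_smul, norm_smul, hnorm, ← coe_linearCombination_toClosedSpan]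
    exact inv_mul_cancel₀ hw0.ne'
  · have hmk : ‖Z.mkQ w‖ ≤ τ := by
      have : Z.mkQ w = Z.mkQ (w - z) := by
        rw [map_sub, (Submodule.Quotient.mk_eq_zero Z).2 hzZ |> fun h => (h : Z.mkQ z = 0),
          sub_zero]
      rw [this]
      exact (Submodule.Quotient.norm_mk_le Z _).trans hwz
    have hinv : ‖w‖⁻¹ ≤ 2 := by
      rw [inv_le_comm₀ hw0 two_pos]
      linarith
    rw [map_smul, map_smul, norm_smul, hnorm]
    calc ‖w‖⁻¹ * ‖Z.mkQ w‖ ≤ 2 * τ := by gcongr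
      _ ≤ ζ := by
        have : τ ≤ ζ / 2 := min_le_right _ _
        linarith

theorem norm_linearCombination_toClosedSpan (y : ℕ → X) (a : ℕ →₀ 𝕜) :
    ‖Finsupp.linearCombination 𝕜 (toClosedSpan 𝕜 y) a‖ = ‖Finsupp.linearCombination 𝕜 y a‖ :=
  congrArg norm (coe_linearCombination_toClosedSpan y a)

theorem exists_continuousLinearMap_extension [CompleteSpace X] {V W : Type*} [AddCommGroup V]
    [Module 𝕜 V] [NormedAddCommGroup W] [NormedSpace 𝕜 W] (f : V →ₗ[𝕜] X) (g : V →ₗ[𝕜] W)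
    (hg : DenseRange g) (h : ∃ K : ℝ, ∀ v, ‖f v‖ ≤ K * ‖g v‖) :
    ∃ T : W →L[𝕜] X, ∀ v, T (g v) = f v :=
  ⟨f.extendOfNorm g, fun v => LinearMap.extendOfNorm_eq hg h v⟩

theorem exists_operator [CompleteSpace X] {x y : ℕ → X} {K : ℝ}
    (hK : ∀ a : ℕ →₀ 𝕜, ‖Finsupp.linearCombination 𝕜 x a‖ ≤
      K * ‖Finsupp.linearCombination 𝕜 y a‖) :
    ∃ T : closedSpan 𝕜 y →L[𝕜] X, ∀ a,
      T (Finsupp.linearCombination 𝕜 (toClosedSpan 𝕜 y) a) = Finsupp.linearCombination 𝕜 x a :=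
  exists_continuousLinearMap_extension _ _ (denseRange_linearCombination_toClosedSpan y)
    ⟨K, fun a => (hK a).trans_eq (by rw [norm_linearCombination_toClosedSpan])⟩

theorem Peeling.isStrictlySingular {e : ℕ → E} {x y : ℕ → X}
    (P : Peeling 𝕜 e x y) (Q : ℕ → X →L[𝕜] X)
    (hQ : ∀ N, FiniteDimensional 𝕜 (Q N).toLinearMap.range)
    (hQ₁ : ∀ N, ∀ i < N, Q N (y i) = y i) (hQ₀ : ∀ N i, N ≤ i → Q N (y i) = 0)
    {T : closedSpan 𝕜 y →L[𝕜] X} (hT : ∀ a,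
      T (Finsupp.linearCombination 𝕜 (toClosedSpan 𝕜 y) a) = Finsupp.linearCombination 𝕜 x a) :
    IsStrictlySingular T := by
  rintro Z hZ ⟨r, hr, hrZ⟩
  let d : Seminorm 𝕜 (ℕ →₀ 𝕜) := (normSeminorm 𝕜 (closedSpan 𝕜 y ⧸ Z)).comp
    (Z.mkQ ∘ₗ Finsupp.linearCombination 𝕜 (toClosedSpan 𝕜 y))
  have hD : 0 < 1 + 2 * ‖T‖ + 2 * r := by positivity
  -- A unit vector within 2η of Z with image at most η would give r(1 - 2η) ≤ η + 2η‖T‖, that is r ≤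
  -- r / 2.
  obtain ⟨η, hη0, hη⟩ : ∃ η : ℝ, 0 < η ∧ η * (1 + 2 * ‖T‖ + 2 * r) = r / 2 :=
    ⟨r / 2 / (1 + 2 * ‖T‖ + 2 * r), by positivity, div_mul_cancel₀ _ hD.ne'⟩
  obtain ⟨a, ha1, had, hax⟩ := P.exists_norm_image_le d (fun N ζ hζ =>
    exists_combination_near Z hZ N (Q N) (hQ N) (hQ₁ N) (hQ₀ N) hζ) hη0
  have had' : ‖Z.mkQ (Finsupp.linearCombination 𝕜 (toClosedSpan 𝕜 y) a)‖ ≤ η := had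
  have hTv := hT a
  rw [← norm_linearCombination_toClosedSpan] at ha1
  generalize Finsupp.linearCombination 𝕜 (toClosedSpan 𝕜 y) a = v at ha1 had' hTv
  obtain ⟨m, hm, hmη⟩ := Submodule.Quotient.norm_mk_lt (Z.mkQ v) hη0
  have hzZ : v - m ∈ Z := (Submodule.Quotient.eq Z).1 hm.symm
  have hm2 : ‖m‖ ≤ 2 * η := by linarith
  have h1 := hrZ _ hzZ
  have h2 : ‖T (v - m)‖ ≤ η + ‖T‖ * (2 * η) := by
    rw [map_sub, hTv]
    exact (norm_sub_le _ _).trans (add_le_add hax ((T.le_opNorm m).trans (by gcongr)))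
  have h3 : 1 - 2 * η ≤ ‖v - m‖ := by
    have := norm_sub_norm_le v m
    linarith
  have h4 : r * (1 - 2 * η) ≤ r * ‖v - m‖ := by gcongr
  have h5 : r * (1 - 2 * η) ≤ η + ‖T‖ * (2 * η) := h4.trans (h1.trans h2)
  linarith

theorem not_isCompactOperator {x y : ℕ → X} (hy : ∃ R, ∀ i, ‖y i‖ ≤ R)
    (hx : ∀ (θ : ℕ → ℕ) (v : X), StrictMono θ → ¬ Tendsto (x ∘ θ) atTop (𝓝 v))
    {T : closedSpan 𝕜 y →L[𝕜] X} (hT : ∀ i, T (toClosedSpan 𝕜 y i) = x i) :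
    ¬ IsCompactOperator T := by
  intro hcomp
  obtain ⟨R, hR⟩ := hy
  obtain ⟨S, hS, hTS⟩ := hcomp.image_subset_compact_of_bounded
    (S := range (toClosedSpan 𝕜 y)) (isBounded_iff_forall_norm_le.2 ⟨R, by
      rintro _ ⟨i, rfl⟩
      exact hR i⟩)
  obtain ⟨v, -, θ, hθ, hlim⟩ := hS.tendsto_subseq (x := x) fun i =>
    hTS ⟨_, mem_range_self i, hT i⟩
  exact hx θ v hθ hlim

theorem Peeling.exists_strictlySingular [CompleteSpace X] {e : ℕ → E} {x y : ℕ → X}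
    (P : Peeling 𝕜 e x y) (Q : ℕ → X →L[𝕜] X)
    (hQ : ∀ N, FiniteDimensional 𝕜 (Q N).toLinearMap.range)
    (hQ₁ : ∀ N, ∀ i < N, Q N (y i) = y i) (hQ₀ : ∀ N i, N ≤ i → Q N (y i) = 0)
    (hy : ∃ R, ∀ i, ‖y i‖ ≤ R)
    (hx : ∀ (θ : ℕ → ℕ) (v : X), StrictMono θ → ¬ Tendsto (x ∘ θ) atTop (𝓝 v)) :
    ∃ Y : Submodule 𝕜 X, IsClosed (Y : Set X) ∧
      ∃ T : Y →L[𝕜] X, IsStrictlySingular T ∧ ¬ IsCompactOperator T := by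
  obtain ⟨K, hK⟩ := P.exists_norm_le
  obtain ⟨T, hT⟩ := exists_operator hK
  refine ⟨closedSpan 𝕜 y, Submodule.isClosed_topologicalClosure _, T,
    P.isStrictlySingular Q hQ hQ₁ hQ₀ hT, not_isCompactOperator hy hx fun i => ?_⟩
  simpa using hT (Finsupp.single i 1)

end Operator

/-! ### Finitely supported vectors and block sequences -/

section Blocks

variable {𝕜 : Type*} [RCLike 𝕜] {X : Type*} [NormedAddCommGroup X] [NormedSpace 𝕜 X]
  (b : SchauderBasis 𝕜 X)

theorem proj_eq_self {v : X} {G : Finset ℕ} (h : supp b v ⊆ G) :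
    GeneralSchauderBasis.proj b G v = v := by
  have h0 : ∀ i, i ∉ G → b.coord i v • b i = 0 := fun i hi => by
    have : b.coord i v = 0 := by
      by_contra hne
      exact hi (h hne)
    rw [this, zero_smul]
  refine tendsto_nhds_unique (tendsto_const_nhds.congr' ?_) (SchauderBasis.tendsto_proj b v)
  filter_upwards [eventually_gt_atTop (G.sup id)] with n hn
  rw [SchauderBasis.proj_apply, GeneralSchauderBasis.proj_apply]
  exact Finset.sum_subset
    (fun i hi => Finset.mem_range.2 ((Finset.le_sup (f := id) hi).trans_lt hn))
    fun i _ hi => h0 i hi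

theorem proj_eq_zero {v : X} {G : Finset ℕ} (h : Disjoint (supp b v) G) :
    GeneralSchauderBasis.proj b G v = 0 := by
  rw [GeneralSchauderBasis.proj_apply]
  refine Finset.sum_eq_zero fun i hi => ?_
  have : b.coord i v = 0 := by
    by_contra hne
    exact Set.disjoint_left.1 h hne hi
  rw [this, zero_smul]

theorem supp_nonempty {v : X} (hv : ‖v‖ = 1) : (supp b v).Nonempty := by
  by_contra h
  have := proj_eq_self b (v := v) (G := ∅) (by simp [not_nonempty_iff_eq_empty.1 h])
  rw [GeneralSchauderBasis.proj_empty, zero_apply] at this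
  rw [← this, norm_zero] at hv
  exact zero_ne_one hv

theorem IsBlockSeq.le_of_mem_supp {b : SchauderBasis 𝕜 X} {z : ℕ → X} (hz : IsBlockSeq b z)
    (hz₁ : IsNormalized z) (j : ℕ) : ∀ i ∈ supp b (z j), j ≤ i := by
  induction j with
  | zero => exact fun i _ => Nat.zero_le i
  | succ j ih =>
    intro i hi
    obtain ⟨m, hm⟩ := supp_nonempty b (hz₁ j)
    exact (Nat.succ_le_succ (ih m hm)).trans (hz j (j + 1) (Nat.lt_succ_self j) m hm i hi)

theorem norm_proj_le_of_unconditional {𝓕 : Set (Finset ℕ)} {C : ℝ}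
    (hC : ∀ a : ℕ →₀ 𝕜, ∀ F ∈ 𝓕, ‖∑ i ∈ F, a i • b i‖ ≤ C * ‖∑ i ∈ a.support, a i • b i‖)
    {v : X} {S : Finset ℕ} (hv : GeneralSchauderBasis.proj b S v = v) {F : Finset ℕ} (hF : F ∈ 𝓕) :
    ‖GeneralSchauderBasis.proj b F v‖ ≤ C * ‖v‖ := by
  let a : ℕ →₀ 𝕜 := Finsupp.onFinset S (fun i => if i ∈ S then b.coord i v else 0)
    fun i hi => by_contra fun h => hi (if_neg h)
  have hsum : ∀ G : Finset ℕ, ∑ i ∈ G, a i • b i = GeneralSchauderBasis.proj b (G ∩ S) v := by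
    intro G
    rw [GeneralSchauderBasis.proj_apply, ← Finset.filter_mem_eq_inter, Finset.sum_filter]
    refine Finset.sum_congr rfl fun i _ => ?_
    by_cases hi : i ∈ S <;> simp [a, hi]
  have hS : ∑ i ∈ a.support, a i • b i = v := by
    have haS : a.support ⊆ S := Finsupp.support_onFinset_subset
    rw [Finset.sum_subset haS fun i _ hi => by rw [Finsupp.notMem_support_iff.1 hi, zero_smul],
      hsum, Finset.inter_self, hv]
  have hF' : ∑ i ∈ F, a i • b i = GeneralSchauderBasis.proj b F v := by
    rw [hsum]
    conv_rhs => rw [← hv]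
    convert (GeneralSchauderBasis.proj_comp b F S v).symm
  have := hC a F hF
  rwa [hS, hF'] at this

/-- Fast subsequences of block sequences have pairwise disjoint supports. -/
theorem exists_disjoint_subsequences (G : ℕ → ℕ → Finset ℕ) (hG : ∀ k j, ∀ i ∈ G k j, j ≤ i)
    (g : ℕ → ℕ → ℕ) : ∃ ψ : ℕ → ℕ → ℕ, (∀ k, StrictMono (ψ k)) ∧ (∀ k n, g k n ≤ ψ k n) ∧
      ∀ k n k' n', (k, n) ≠ (k', n') → Disjoint (G k (ψ k n)) (G k' (ψ k' n')) := by
  let g' : ℕ → ℕ := fun σ => g (Nat.unpair σ).2 (Nat.unpair σ).1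
  -- The pair (n, k) is coded by σ ≥ k. Each new value of T passes the supports chosen so far for
  -- all k ≤ σ, hence for the k that σ codes.
  let T : ℕ → ℕ := fun σ => Nat.rec (g' 0)
    (fun σ t => t + 1 + (Finset.range (σ + 1)).sup (fun k => (G k t).sup id) + g' (σ + 1)) σ
  have hT : ∀ σ, T (σ + 1) = T σ + 1 +
      (Finset.range (σ + 1)).sup (fun k => (G k (T σ)).sup id) + g' (σ + 1) := fun σ => rfl
  have hmono : StrictMono T := strictMono_nat_of_lt_succ fun σ => by
    rw [hT]
    omega
  have hg : ∀ σ, g' σ ≤ T σ := by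
    rintro (_ | σ)
    · exact le_rfl
    · rw [hT]
      omega
  have hlt : ∀ σ σ' k, σ < σ' → k ≤ σ → ∀ i ∈ G k (T σ), i < T σ' := by
    intro σ σ' k hσ hk i hi
    have h1 : i ≤ (Finset.range (σ + 1)).sup (fun k => (G k (T σ)).sup id) :=
      (Finset.le_sup (f := id) hi).trans (Finset.le_sup (f := fun k => (G k (T σ)).sup id)
        (Finset.mem_range.2 (Nat.lt_succ_of_le hk)))
    have h2 : T (σ + 1) ≤ T σ' := hmono.monotone hσ
    rw [hT] at h2
    omega
  have hdisj : ∀ σ σ' k k', σ < σ' → k ≤ σ → Disjoint (G k (T σ)) (G k' (T σ')) :=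
    fun σ σ' k k' hσ hk => Finset.disjoint_left.2 fun i hi hi' =>
      (hlt σ σ' k hσ hk i hi).not_ge (hG _ _ i hi')
  refine ⟨fun k n => T (Nat.pair n k), fun k n n' hn => hmono (Nat.pair_lt_pair_left k hn),
    fun k n => by simpa [g'] using hg (Nat.pair n k), fun k n k' n' hne => ?_⟩
  have hpair : Nat.pair n k ≠ Nat.pair n' k' := fun h => by
    obtain ⟨h1, h2⟩ := Nat.pair_eq_pair.1 h
    exact hne (by rw [h1, h2])
  rcases hpair.lt_or_gt with h | h
  · exact hdisj _ _ k k' h (Nat.right_le_pair n k)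
  · exact (hdisj _ _ k' k h (Nat.right_le_pair n' k')).symm

/-- The sums `∑ k ≤ i, 2⁻ᵏ • w k i`. -/
noncomputable def weightedSum (𝕜 : Type*) [RCLike 𝕜] {X : Type*} [NormedAddCommGroup X]
    [NormedSpace 𝕜 X] (w : ℕ → ℕ → X) (i : ℕ) : X :=
  ∑ k ∈ Finset.range (i + 1), (((1 / 2) ^ k : ℝ) : 𝕜) • w k i

theorem norm_weightedSum_le {w : ℕ → ℕ → X} (hw : ∀ k i, ‖w k i‖ = 1) (i : ℕ) :
    ‖weightedSum 𝕜 w i‖ ≤ 2 := by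
  refine (norm_sum_le _ _).trans ?_
  refine (Finset.sum_le_sum fun k _ => ?_).trans (sum_geometric_two_le (i + 1))
  rw [norm_smul, hw, mul_one, RCLike.norm_ofReal, abs_of_nonneg (by positivity)]

variable {w : ℕ → ℕ → X} {W : ℕ → ℕ → Finset ℕ} (hW : ∀ k i, (W k i : Set ℕ) = supp b (w k i))
  (hd : ∀ k i k' i', (k, i) ≠ (k', i') → Disjoint (W k i) (W k' i'))

include hW

theorem proj_block_eq_self {k i : ℕ} {F : Finset ℕ} (h : W k i ⊆ F) :
    GeneralSchauderBasis.proj b F (w k i) = w k i :=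
  proj_eq_self b (by rw [← hW]; exact_mod_cast h)

theorem proj_block_eq_zero {k i : ℕ} {F : Finset ℕ} (h : Disjoint (W k i) F) :
    GeneralSchauderBasis.proj b F (w k i) = 0 :=
  proj_eq_zero b (by rw [← hW]; exact_mod_cast h)

theorem exists_proj_linearCombination_eq_self (a : ℕ →₀ 𝕜) : ∃ S : Finset ℕ,
    GeneralSchauderBasis.proj b S (Finsupp.linearCombination 𝕜 (weightedSum 𝕜 w) a) =
      Finsupp.linearCombination 𝕜 (weightedSum 𝕜 w) a := by
  refine ⟨a.support.biUnion fun i => (Finset.range (i + 1)).biUnion fun k => W k i, ?_⟩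
  rw [Finsupp.linearCombination_apply, Finsupp.sum, map_sum]
  refine Finset.sum_congr rfl fun i hi => ?_
  rw [map_smul, weightedSum, map_sum]
  congr 1
  refine Finset.sum_congr rfl fun k hk => ?_
  rw [map_smul, proj_block_eq_self b hW]
  intro j hj
  exact Finset.mem_biUnion.2 ⟨i, hi, Finset.mem_biUnion.2 ⟨k, hk, hj⟩⟩

include hd

/-- Disjointness of the supports isolates the k-th layer. The condition k ≤ i is what puts `w k i`
among the summands of the i-th vector. -/
theorem proj_linearCombination_weightedSum (k : ℕ) {A : Finset ℕ} (hA : ∀ i ∈ A, k ≤ i)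
    (a : ℕ →₀ 𝕜) : GeneralSchauderBasis.proj b (A.biUnion (W k))
      (Finsupp.linearCombination 𝕜 (weightedSum 𝕜 w) a) =
        (((1 / 2) ^ k : ℝ) : 𝕜) • ∑ i ∈ A, a i • w k i := by
  have hone : ∀ i, GeneralSchauderBasis.proj b (A.biUnion (W k)) (weightedSum 𝕜 w i) =
      if i ∈ A then (((1 / 2) ^ k : ℝ) : 𝕜) • w k i else 0 := by
    intro i
    have hne : ∀ k', (k' ≠ k ∨ i ∉ A) →
        GeneralSchauderBasis.proj b (A.biUnion (W k)) (w k' i) = 0 := fun k' h => by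
      refine proj_block_eq_zero b hW ((Finset.disjoint_biUnion_right _ _ _).2 fun i' hi' => ?_)
      refine hd _ _ _ _ fun heq => ?_
      simp only [Prod.mk.injEq] at heq
      rcases h with h | h
      exacts [h heq.1, h (heq.2 ▸ hi')]
    rw [weightedSum, map_sum]
    split_ifs with hi
    · rw [Finset.sum_eq_single k]
      · rw [map_smul, proj_block_eq_self b hW (Finset.subset_biUnion_of_mem (W k) hi)]
      · intro k' _ hk'
        rw [map_smul, hne k' (Or.inl hk'), smul_zero]
      · intro hk
        exact absurd (Finset.mem_range.2 (Nat.lt_succ_of_le (hA i hi))) hk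
    · exact Finset.sum_eq_zero fun k' _ => by rw [map_smul, hne k' (Or.inr hi), smul_zero]
  rw [linearCombination_eq_sum_of_subset _ a (Finset.subset_union_left (s₂ := A)), map_sum,
    Finset.smul_sum]
  simp only [map_smul, hone, smul_ite, smul_zero]
  rw [← Finset.sum_filter, Finset.filter_mem_eq_inter,
    Finset.inter_eq_right.2 Finset.subset_union_right]
  exact Finset.sum_congr rfl fun i _ => smul_comm _ _ _

theorem exists_initial_projections : ∃ Q : ℕ → X →L[𝕜] X,
    (∀ N, FiniteDimensional 𝕜 (Q N).toLinearMap.range) ∧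
    (∀ N, ∀ i < N, Q N (weightedSum 𝕜 w i) = weightedSum 𝕜 w i) ∧
    ∀ N i, N ≤ i → Q N (weightedSum 𝕜 w i) = 0 := by
  refine ⟨fun N => GeneralSchauderBasis.proj b
    ((Finset.range N).biUnion fun i => (Finset.range (i + 1)).biUnion fun k => W k i),
    fun N => ?_, fun N i hi => ?_, fun N i hi => ?_⟩
  · rw [GeneralSchauderBasis.range_proj_eq_span]
    exact FiniteDimensional.span_of_finite 𝕜 ((Finset.finite_toSet _).image _)
  · rw [weightedSum, map_sum]
    refine Finset.sum_congr rfl fun k hk => ?_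
    rw [map_smul, proj_block_eq_self b hW]
    intro j hj
    exact Finset.mem_biUnion.2 ⟨i, Finset.mem_range.2 hi, Finset.mem_biUnion.2 ⟨k, hk, hj⟩⟩
  · rw [weightedSum, map_sum]
    refine Finset.sum_eq_zero fun k _ => ?_
    rw [map_smul, proj_block_eq_zero b hW, smul_zero]
    refine (Finset.disjoint_biUnion_right _ _ _).2 fun i' hi' =>
      (Finset.disjoint_biUnion_right _ _ _).2 fun k' _ => hd _ _ _ _ fun heq => ?_
    simp only [Prod.mk.injEq] at heq
    have := Finset.mem_range.1 hi'
    omega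

end Blocks

/-! ### Subsequences -/

section Subsequences

variable {𝕜 : Type*} [RCLike 𝕜] {E X : Type*} [NormedAddCommGroup E] [NormedSpace 𝕜 E]
  [NormedAddCommGroup X] [NormedSpace 𝕜 X]

theorem sum_image_invFun {f : ℕ → ℕ} (hf : Function.Injective f) (a : ℕ → 𝕜) (A : Finset ℕ)
    (x : ℕ → X) : ∑ j ∈ A.image f, a (Function.invFun f j) • x j = ∑ i ∈ A, a i • x (f i) := by
  rw [Finset.sum_image hf.injOn]
  exact Finset.sum_congr rfl fun i _ => by rw [Function.leftInverse_invFun hf i]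

theorem DominatesOn.comp {C : ℝ} {A : Finset ℕ} {f : ℕ → ℕ} (hf : Function.Injective f)
    {x : ℕ → X} {y : ℕ → E} (h : DominatesOn 𝕜 C (A.image f) x y) :
    DominatesOn 𝕜 C A (fun i => x (f i)) fun i => y (f i) := fun a => by
  have := h fun j => a (Function.invFun f j)
  rwa [sum_image_invFun hf, sum_image_invFun hf] at this

theorem exists_dominatesOn_subsequence (e : ℕ → E)
    (he : ∀ φ : ℕ → ℕ, StrictMono φ → Dominates 𝕜 (fun i => e (φ i)) e) :
    ∃ L s : ℕ, ∀ ψ : ℕ → ℕ, StrictMono ψ → (∀ i, i + s ≤ ψ i) → ∀ A : Finset ℕ,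
      (∀ i ∈ A, L ≤ i) → DominatesOn 𝕜 L A (fun i => e (ψ i)) e := by
  obtain ⟨L, s, h⟩ := exists_uniform_domination e he
  refine ⟨L, s, fun ψ hψ hs A hA a => ?_⟩
  let f : ℕ →₀ 𝕜 := Finsupp.onFinset A (fun i => if i ∈ A then a i else 0)
    fun i hi => by_contra fun h => hi (if_neg h)
  have hfA : f.support ⊆ A := Finsupp.support_onFinset_subset
  have hsum : ∀ u : ℕ → E, ∑ i ∈ f.support, f i • u i = ∑ i ∈ A, a i • u i := fun u => by
    rw [Finset.sum_subset hfA fun i _ hi => by rw [Finsupp.notMem_support_iff.1 hi, zero_smul]]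
    exact Finset.sum_congr rfl fun i hi => by simp [f, hi]
  have := h ψ hψ hs f fun i hi => hA i (hfA hi)
  rwa [hsum, hsum] at this

theorem norm_le_of_starDelta_le {𝓕 : Set (Finset ℕ)} (h𝓕 : IsLowerSet 𝓕) {n : ℕ} {x : ℕ → X}
    {e : ℕ → E} {η : ℝ} (hη : 0 ≤ η) (h : starDelta 𝕜 𝓕 n x e ≤ ENNReal.ofReal η) {φ : ℕ → ℕ}
    (hφ : Function.Injective φ) (a : ℕ →₀ 𝕜)
    (ha : ∀ A : Finset ℕ, A.image φ ∈ 𝓕 → ‖∑ i ∈ A, a i • e (φ i)‖ ≤ 1 / 2 ^ n)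
    (ha₁ : ‖Finsupp.linearCombination 𝕜 (e ∘ φ) a‖ ≤ 1) :
    ‖Finsupp.linearCombination 𝕜 (x ∘ φ) a‖ ≤ η := by
  rw [← Finsupp.linearCombination_mapDomain] at ha₁ ⊢
  rw [Finsupp.linearCombination_apply, Finsupp.sum] at ha₁ ⊢
  have hF : ∀ F ∈ 𝓕, ‖∑ j ∈ F, (a.mapDomain φ) j • e j‖ ≤ 1 / 2 ^ n := by
    intro F hF
    have := ha (F.preimage φ hφ.injOn) (h𝓕 (by
      intro j hj
      obtain ⟨i, hi, rfl⟩ := Finset.mem_image.1 hj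
      exact Finset.mem_preimage.1 hi) hF)
    rw [← Finset.sum_preimage φ F hφ.injOn]
    · simpa only [Finsupp.mapDomain_apply hφ] using this
    · intro j _ hj
      rw [Finsupp.mapDomain_of_notMem_range _ _ hj, zero_smul]
  have h1 : ‖∑ i ∈ (a.mapDomain φ).support, (a.mapDomain φ) i • x i‖ₑ ≤ starDelta 𝕜 𝓕 n x e :=
    le_iSup_of_le (a.mapDomain φ) (le_iSup_of_le hF (le_iSup_of_le ha₁ le_rfl))
  have h2 := h1.trans h
  rwa [← ofReal_norm, ENNReal.ofReal_le_ofReal_iff hη] at h2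

theorem exists_lt_norm_sum_biUnion_comp [CompleteSpace E] (e : UnconditionalSchauderBasis ℕ 𝕜 E)
    (hE : ¬ ContainsC0nUniformly 𝕜 E) (R : ℝ) {ε : ℝ} (hε : 0 < ε) :
    ∃ l : ℕ, ∀ φ : ℕ → ℕ, Function.Injective φ → ∀ (a : ℕ → 𝕜) (s : Finset (Finset ℕ)),
      s.card = l → (∀ F ∈ s, ∀ G ∈ s, F ≠ G → Disjoint F G) →
      (∀ F ∈ s, ε ≤ ‖∑ i ∈ F, a i • e (φ i)‖) →
      R < ‖∑ i ∈ s.biUnion id, a i • e (φ i)‖ := by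
  obtain ⟨l, hl⟩ := exists_lt_norm_sum_biUnion e hE (R / ε)
  refine ⟨l, fun φ hφ a s hs hd hge => ?_⟩
  let a' : ℕ → 𝕜 := fun i => ((ε⁻¹ : ℝ) : 𝕜) * a i
  have hnorm : ∀ F : Finset ℕ, ‖∑ j ∈ F.image φ, a' (Function.invFun φ j) • e j‖ =
      ε⁻¹ * ‖∑ i ∈ F, a i • e (φ i)‖ := fun F => by
    rw [sum_image_invFun hφ]
    simp only [a', mul_smul]
    rw [← Finset.smul_sum, norm_smul, RCLike.norm_ofReal, abs_of_pos (by positivity)]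
  have himg : (s.image (Finset.image φ)).biUnion id = (s.biUnion id).image φ := by
    rw [Finset.image_biUnion, Finset.biUnion_image]
    rfl
  have := hl (fun j => a' (Function.invFun φ j)) (s.image (Finset.image φ))
    (by rw [Finset.card_image_of_injective _ (Finset.image_injective hφ), hs]) ?_ ?_
  · rw [himg, hnorm, div_eq_inv_mul] at this
    exact lt_of_mul_lt_mul_left this (by positivity)
  · intro A hA B hB hAB
    obtain ⟨F, hF, rfl⟩ := Finset.mem_image.1 hA
    obtain ⟨G, hG, rfl⟩ := Finset.mem_image.1 hB
    exact (Finset.disjoint_image hφ).2 (hd F hF G hG fun h => hAB (by rw [h]))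
  · intro A hA
    obtain ⟨F, hF, rfl⟩ := Finset.mem_image.1 hA
    rw [hnorm]
    calc (1 : ℝ) = ε⁻¹ * ε := (inv_mul_cancel₀ hε.ne').symm
      _ ≤ _ := by
        gcongr
        exact hge F hF

/-- Every coordinate functional is eventually zero along the subsequence, so a limit would be 0,
against normalization. -/
theorem IsBasicSeq.not_tendsto {x : ℕ → X} (hx : IsBasicSeq 𝕜 x) (hx₁ : IsNormalized x)
    {θ : ℕ → ℕ} (hθ : StrictMono θ) (v : X) : ¬ Tendsto (x ∘ θ) atTop (𝓝 v) := by
  intro hlim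
  obtain ⟨b, hb⟩ := hx
  have hv : v ∈ closedSpan 𝕜 x :=
    (Submodule.isClosed_topologicalClosure _).mem_of_tendsto hlim
      (Eventually.of_forall fun n => Submodule.le_topologicalClosure _
        (Submodule.subset_span (mem_range_self _)))
  have hlim' : Tendsto (fun n => b (θ n)) atTop (𝓝 ⟨v, hv⟩) := by
    rw [tendsto_subtype_rng]
    simpa only [hb, Function.comp_def] using hlim
  have hcoord : ∀ j, b.coord j ⟨v, hv⟩ = 0 := fun j => by
    have h1 : Tendsto (fun n => b.coord j (b (θ n))) atTop (𝓝 (b.coord j ⟨v, hv⟩)) :=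
      ((b.coord j).continuous.tendsto _).comp hlim'
    refine tendsto_nhds_unique h1 (tendsto_const_nhds.congr' ?_)
    filter_upwards [eventually_gt_atTop j] with n hn
    have hne : j ≠ θ n := (hn.trans_le hθ.le_apply).ne
    rw [b.ortho]
    simp [hne]
  have h0 : (⟨v, hv⟩ : closedSpan 𝕜 x) = 0 := by
    rw [← proj_eq_self b (v := ⟨v, hv⟩) (G := ∅) fun j hj => absurd (hcoord j) hj]
    simp
  have hv0 : v = 0 := congrArg Subtype.val h0
  have hn := hlim.norm
  simp only [Function.comp_apply, hx₁ _, hv0, norm_zero] at hn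
  exact one_ne_zero (tendsto_nhds_unique tendsto_const_nhds hn)

end Subsequences

/-! ### The dominating sequence, the absorbing families and the main theorem -/

theorem singleton_mem_schreier {c : Ordinal.{0} → ℕ → Ordinal.{0}} (hc : IsApproximating c)
    (β : Ordinal.{0}) (hβ₁ : β < ω₁) (i : ℕ) : {i} ∈ schreier c β := by
  induction β using Ordinal.limitRecOn with
  | zero => simp [schreier_zero]
  | add_one β ih => exact schreier_subset_add_one c β (ih ((lt_add_one β).trans hβ₁))
  | limit β hβ ih =>
    rw [schreier_limit c β hβ]
    have := (hc β hβ hβ₁).2.1 0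
    exact ⟨0, this, ih _ this (this.trans hβ₁), by simp⟩

variable {𝕜 : Type*} [RCLike 𝕜] {E X : Type*} [NormedAddCommGroup E] [NormedSpace 𝕜 E]
  [NormedAddCommGroup X] [NormedSpace 𝕜 X]

/-- If `(e_i)` is dominated on the Schreier families of order below `α` by block sequences with
supports in Schreier families of finite order, then a single sequence in `X` dominates a
subsequence of `(e_i)` on any prescribed families of index below `ω ^ α`, with constants that do
not depend on the families. -/
theorem exists_dominating_sequence {c : Ordinal.{0} → ℕ → Ordinal.{0}} (hc : IsApproximating c)
    {α : Ordinal.{0}} (hα : Order.IsSuccLimit α) (hα₁ : α < ω₁) (b : SchauderBasis 𝕜 X)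
    (hb : IsFamilyUnconditional 𝕜 (schreier c α) b) (e : ℕ → E)
    (he : ∀ φ : ℕ → ℕ, StrictMono φ → Dominates 𝕜 (fun i => e (φ i)) e)
    (h : ∃ C : ℝ, 1 ≤ C ∧ ∀ β < α, ∃ (r : ℕ) (x : ℕ → X), IsNormalized x ∧ IsBlockSeq b x ∧
      (∀ i, ∃ G ∈ schreier c (r : Ordinal.{0}), (G : Set ℕ) = supp b (x i)) ∧
      ∀ F ∈ schreier c β, DominatesOn 𝕜 C F x e) :
    ∃ B : ℝ, 1 ≤ B ∧ ∀ 𝓖 : ℕ → Set (Finset ℕ), (∀ k, IsLowerSet (𝓖 k)) →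
      (∀ k, ∃ o < ω ^ α, IndexLE o (𝓖 k)) → ∃ (φ : ℕ → ℕ) (y : ℕ → X) (Q : ℕ → X →L[𝕜] X),
        StrictMono φ ∧ (∀ i, ‖y i‖ ≤ 2) ∧ (∀ N, FiniteDimensional 𝕜 (Q N).toLinearMap.range) ∧
        (∀ N, ∀ i < N, Q N (y i) = y i) ∧ (∀ N i, N ≤ i → Q N (y i) = 0) ∧
        ∀ k, ∀ A : Finset ℕ, A.image φ ∈ 𝓖 k → ∀ a : ℕ →₀ 𝕜,
          ‖∑ i ∈ A, a i • e (φ i)‖ ≤ B * 2 ^ k * ‖Finsupp.linearCombination 𝕜 y a‖ := by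
  obtain ⟨C, hC₁, hC⟩ := h
  obtain ⟨Cb, hCb₁, hCb⟩ := hb
  obtain ⟨L, s, hL⟩ := exists_dominatesOn_subsequence e he
  have hA0 : (0 : ℝ) ≤ L * C * Cb := by positivity
  -- B is fixed before 𝓖, because the families are later built from numbers l k that depend on B.
  -- The factor 2 accounts for the indices below k and those from k on.
  refine ⟨2 * (L * C * Cb + 1), by linarith, fun 𝓖 hlow hind => ?_⟩
  obtain ⟨β, hβ, φ, hφ, hLφ, hφβ⟩ := exists_subsequence_forall_mem_schreier hc hα hα₁ 𝓖 hind L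
  choose r z hz₁ hz hsupp hdom using fun k => hC (β k) (hβ k)
  choose G hG hGsupp using hsupp
  have hrβ : ∀ k, (r k : Ordinal.{0}) + β k < α := fun k => natCast_add_lt hα (hβ k) (r k)
  choose hh hhh using fun k => exists_biUnion_mem_schreier hc (r k) (β k) ((hrβ k).trans hα₁)
  choose q hq using fun k => exists_tail_schreier_subset hc α hα₁ _ (hrβ k).le
  have hGle : ∀ k j, ∀ i ∈ G k j, j ≤ i := fun k j i hi =>
    (hz k).le_of_mem_supp (hz₁ k) j i (by rw [← hGsupp]; exact hi)
  -- Three lower bounds on ψ: `hh k n` puts unions of supports in S_{r+β}, `q k` moves these into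
  -- S_α, and `n + s` allows uniform domination.
  obtain ⟨ψ, hψ, hgψ, hdisj⟩ := exists_disjoint_subsequences G hGle
    fun k n => max (max (hh k n) (q k)) (n + s)
  let w : ℕ → ℕ → X := fun k i => z k (ψ k (φ i))
  let W : ℕ → ℕ → Finset ℕ := fun k i => G k (ψ k (φ i))
  have hW : ∀ k i, (W k i : Set ℕ) = supp b (w k i) := fun k i => hGsupp k _
  have hd : ∀ k i k' i', (k, i) ≠ (k', i') → Disjoint (W k i) (W k' i') :=
    fun k i k' i' hne => hdisj _ _ _ _ fun heq => hne (by
      simp only [Prod.mk.injEq] at heq ⊢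
      exact ⟨heq.1, hφ.injective heq.2⟩)
  obtain ⟨Q, hQ, hQ₁, hQ₀⟩ := exists_initial_projections b hW hd
  have key : ∀ k, ∀ A : Finset ℕ, (∀ i ∈ A, k ≤ i) → A.image φ ∈ schreier c (β k) →
      ∀ a : ℕ →₀ 𝕜, ‖∑ i ∈ A, a i • e (φ i)‖ ≤
        L * C * Cb * 2 ^ k * ‖Finsupp.linearCombination 𝕜 (weightedSum 𝕜 w) a‖ := by
    intro k A hkA hA a
    have h1 : ‖∑ i ∈ A, a i • e (φ i)‖ ≤ L * ‖∑ i ∈ A, a i • e (ψ k (φ i))‖ :=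
      (hL (ψ k) (hψ k) (fun i => (le_max_right _ _).trans (hgψ k i)) (A.image φ)
        (Finset.forall_mem_image.2 fun i _ => hLφ i)).comp hφ.injective a
    have h2 : ‖∑ i ∈ A, a i • e (ψ k (φ i))‖ ≤ C * ‖∑ i ∈ A, a i • w k i‖ :=
      ((hdom k _ (image_mem_schreier c (hψ k) _ _ hA)).comp (hψ k).injective).comp hφ.injective a
    have hU : A.biUnion (W k) ∈ schreier c α := by
      have hge : ∀ n, ∀ j ∈ G k (ψ k n), max (hh k n) (q k) ≤ j := fun n j hj =>
        ((le_max_left _ _).trans (hgψ k n)).trans (hGle k _ j hj)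
      have himg : A.biUnion (W k) = (A.image φ).biUnion fun n => G k (ψ k n) := by
        rw [Finset.image_biUnion]
      rw [himg]
      refine hq k _ (hhh k _ hA _ (fun n _ => hG k _) (fun n _ n' _ hn j hj j' hj' => ?_)
        fun n _ j hj => (le_max_left _ _).trans (hge n j hj)) fun j hj => ?_
      · exact hz k _ _ (hψ k hn) j (by rw [← hGsupp]; exact hj) j' (by rw [← hGsupp]; exact hj')
      · obtain ⟨n, _, hn⟩ := Finset.mem_biUnion.1 hj
        exact (le_max_right _ _).trans (hge n j hn)
    obtain ⟨S, hS⟩ := exists_proj_linearCombination_eq_self b hW a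
    have h3 := norm_proj_le_of_unconditional b hCb hS hU
    rw [proj_linearCombination_weightedSum b hW hd k hkA, norm_smul, RCLike.norm_ofReal,
      abs_of_nonneg (by positivity)] at h3
    have h4 : ‖∑ i ∈ A, a i • w k i‖ ≤
        2 ^ k * (Cb * ‖Finsupp.linearCombination 𝕜 (weightedSum 𝕜 w) a‖) := by
      calc ‖∑ i ∈ A, a i • w k i‖ = 2 ^ k * ((1 / 2) ^ k * ‖∑ i ∈ A, a i • w k i‖) := by
            rw [← mul_assoc, ← mul_pow]; norm_num
        _ ≤ _ := by gcongr
    calc ‖∑ i ∈ A, a i • e (φ i)‖ ≤ L * (C * (2 ^ k * (Cb *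
          ‖Finsupp.linearCombination 𝕜 (weightedSum 𝕜 w) a‖))) :=
          h1.trans (by gcongr; exact h2.trans (by gcongr))
      _ = _ := by ring
  refine ⟨φ, weightedSum 𝕜 w, Q, hφ, norm_weightedSum_le fun k i => hz₁ k _, hQ, hQ₁, hQ₀,
    fun k A hA a => ?_⟩
  set v := Finsupp.linearCombination 𝕜 (weightedSum 𝕜 w) a
  -- The k-th layer is absent from the first k vectors. These indices are treated singly through
  -- layer 0, at the cost of a factor k ≤ 2^k.
  have h1 : ‖∑ i ∈ A.filter (· < k), a i • e (φ i)‖ ≤ 2 ^ k * (L * C * Cb * ‖v‖) := by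
    have hcard : ((A.filter (· < k)).card : ℝ) ≤ 2 ^ k := by
      have : (A.filter (· < k)).card ≤ 2 ^ k :=
        (Finset.card_le_card (t := Finset.range k) fun i hi =>
          Finset.mem_range.2 (Finset.mem_filter.1 hi).2).trans
            ((Finset.card_range k).trans_le Nat.lt_two_pow_self.le)
      exact_mod_cast this
    refine (norm_sum_le_of_le (f := fun i => a i • e (φ i)) (n := fun _ => L * C * Cb * ‖v‖) _
      fun i _ => ?_).trans ?_
    · have := key 0 {i} (fun _ _ => Nat.zero_le _)
        (by simpa using singleton_mem_schreier hc (β 0) ((hβ 0).trans hα₁) (φ i)) a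
      simpa using this
    · rw [Finset.sum_const, nsmul_eq_mul]
      gcongr
  have h2 : ‖∑ i ∈ A.filter (¬ · < k), a i • e (φ i)‖ ≤ L * C * Cb * 2 ^ k * ‖v‖ := by
    have hk : ∀ i ∈ A.filter (¬ · < k), k ≤ i := fun i hi => not_lt.1 (Finset.mem_filter.1 hi).2
    exact key k _ hk (hφβ k _ hk
      (hlow k (Finset.image_subset_image (Finset.filter_subset _ _)) hA)) a
  rw [← Finset.sum_filter_add_sum_filter_not A (· < k)]
  refine (norm_add_le _ _).trans ((add_le_add h1 h2).trans ?_)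
  have : 0 ≤ 2 ^ k * ‖v‖ := by positivity
  linarith

/-- Families of index below `ω ^ α` that absorb a given increasing sequence of regular families
and are closed under prescribed finite unions. -/
theorem exists_families {α : Ordinal.{0}} (hα : α ≠ 0) {𝓕 : ℕ → Set (Finset ℕ)}
    (h𝓕 : ∀ n, IsRegular (𝓕 n)) (hcb : ∀ n, cbIndex (𝓕 n) ≤ ω ^ α) (l : ℕ → ℕ) :
    ∃ 𝓖 : ℕ → Set (Finset ℕ), (∀ k, IsLowerSet (𝓖 k)) ∧ (∀ k, ∃ o < ω ^ α, IndexLE o (𝓖 k)) ∧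
      (∀ k, 𝓕 k ⊆ 𝓖 k) ∧ (∀ k, 𝓖 k ⊆ 𝓖 (k + 1)) ∧ ∀ k, unions (l k) (𝓖 k) ⊆ 𝓖 (k + 1) := by
  let 𝓖 : ℕ → Set (Finset ℕ) := fun k =>
    Nat.rec (𝓕 0) (fun k 𝓗 => unions (l k) 𝓗 ∪ (𝓗 ∪ 𝓕 (k + 1))) k
  have hsucc : ∀ k, 𝓖 (k + 1) = unions (l k) (𝓖 k) ∪ (𝓖 k ∪ 𝓕 (k + 1)) := fun k => rfl
  have hind𝓕 : ∀ n, ∃ o < ω ^ α, IndexLE o (𝓕 n) := fun n =>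
    ((h𝓕 n).indexLE.mono (hcb n)).exists_lt
      (Ordinal.isSuccLimit_opow_left Ordinal.isSuccLimit_omega0 hα)
  refine ⟨𝓖, fun k => ?_, fun k => ?_, fun k => ?_, fun k => ?_, fun k => ?_⟩
  · induction k with
    | zero => exact (h𝓕 0).isLowerSet
    | succ k ih =>
      exact (isLowerSet_unions (l k) ih).union (ih.union (h𝓕 (k + 1)).isLowerSet)
  · induction k with
    | zero => exact hind𝓕 0
    | succ k ih =>
      obtain ⟨o, ho, h⟩ := ih
      obtain ⟨o₁, ho₁, h₁⟩ := exists_indexLE_unions hα h ho (l k)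
      obtain ⟨o₂, ho₂, h₂⟩ := hind𝓕 (k + 1)
      exact ⟨max o₁ (max o o₂), max_lt ho₁ (max_lt ho ho₂), (h₁.mono (le_max_left _ _)).union
        ((h.mono ((le_max_left _ _).trans (le_max_right _ _))).union
          (h₂.mono ((le_max_right _ _).trans (le_max_right _ _))))⟩
  · cases k with
    | zero => exact Subset.rfl
    | succ k =>
      rw [hsucc]
      exact subset_union_right.trans subset_union_right
  · rw [hsucc]
    exact subset_union_left.trans subset_union_right
  · rw [hsucc]
    exact subset_union_left

end SchreierOp

theorem mainTheorem1 {𝕜 : Type*} [RCLike 𝕜]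
    {X : Type*} [NormedAddCommGroup X] [NormedSpace 𝕜 X] [CompleteSpace X]
    {E : Type*} [NormedAddCommGroup E] [NormedSpace 𝕜 E] [CompleteSpace E]
    (c : Ordinal.{0} → ℕ → Ordinal.{0}) (hc : SchreierOp.IsApproximating c)
    (α : Ordinal.{0}) (hα : Order.IsSuccLimit α) (hα₁ : α < ω₁)
    (b : SchauderBasis 𝕜 X)
    (hb : SchreierOp.IsFamilyUnconditional 𝕜 (SchreierOp.schreier c α) b)
    (e : UnconditionalSchauderBasis ℕ 𝕜 E)
    (he : ∀ φ : ℕ → ℕ, StrictMono φ → SchreierOp.Dominates 𝕜 (fun i => e (φ i)) e)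
    (hE : ¬ SchreierOp.ContainsC0nUniformly 𝕜 E)
    (h₁ : ∃ x : ℕ → X, SchreierOp.IsNormalized x ∧ SchreierOp.StronglyDominates 𝕜 c α e x)
    (h₂ : ∃ C : ℝ, 1 ≤ C ∧ ∀ β < α, ∃ (r : ℕ) (x : ℕ → X),
      SchreierOp.IsNormalized x ∧ SchreierOp.IsBlockSeq b x ∧
      (∀ i, ∃ G ∈ SchreierOp.schreier c (r : Ordinal.{0}), (G : Set ℕ) = SchreierOp.supp b (x i)) ∧
      ∀ F ∈ SchreierOp.schreier c β, SchreierOp.DominatesOn 𝕜 C F x e) :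
    ∃ Y : Submodule 𝕜 X, IsClosed (Y : Set X) ∧
      ∃ T : Y →L[𝕜] X, SchreierOp.IsStrictlySingular T ∧ ¬ IsCompactOperator T := by
  open SchreierOp in
  obtain ⟨x, hx₁, hx⟩ := h₁
  obtain ⟨𝓕, h𝓕, h𝓕mono, hlub, hΔ⟩ := hx.star
  obtain ⟨B, hB, hdom⟩ := exists_dominating_sequence hc hα hα₁ b hb e he h₂
  let C : ℕ → ℝ := fun k => B * 2 ^ k
  have hC₁ : ∀ k, 1 ≤ C k := fun k => one_le_mul_of_one_le_of_one_le hB (one_le_pow₀ one_le_two)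
  -- The peeled parts have norm up to C (k + 2) and must be divided by it before the estimate on Δ
  -- applies; the extra divisor restores the bound 2^{-k}.
  obtain ⟨n, hn, hnΔ⟩ : ∃ n : ℕ → ℕ, StrictMono n ∧
      ∀ k, starDelta 𝕜 (𝓕 (n k)) (n k) x e ≤ ENNReal.ofReal ((1 / 2) ^ k / C (k + 2)) :=
    extraction_forall_of_eventually fun k => hΔ.eventually_le_const
      (ENNReal.ofReal_pos.2 (div_pos (by positivity) (one_pos.trans_le (hC₁ _))))
  choose l hl using fun k => exists_lt_norm_sum_biUnion_comp e hE (C (k + 1))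
    (ε := (1 / 2) ^ n k) (by positivity)
  obtain ⟨𝓖, hlow, hind, h𝓕𝓖, hsucc, hunions⟩ := exists_families
    (𝓕 := fun k => 𝓕 (n k)) hα.ne_bot (fun k => h𝓕 (n k)) (fun k => hlub.1 ⟨n k, rfl⟩) l
  obtain ⟨φ, y, Q, hφ, hy, hQ, hQ₁, hQ₀, hey⟩ := hdom 𝓖 hlow hind
  let P : Peeling 𝕜 (fun i => e (φ i)) (x ∘ φ) y :=
    { H := fun k => {A | A.image φ ∈ 𝓖 k}
      C := C
      ε := fun k => (1 / 2) ^ n k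
      δ := fun k => (1 / 2) ^ k
      l := l
      isLowerSet := fun k A A' hA' hA => hlow k (Finset.image_subset_image hA') hA
      subset_succ := fun k A hA => hsucc k hA
      unions_subset := by
        rintro k _ ⟨s, hs, hsH, rfl⟩
        refine hunions k ⟨s.image (Finset.image φ), Finset.card_image_le.trans hs, ?_, ?_⟩
        · exact Finset.forall_mem_image.2 hsH
        · rw [Finset.image_biUnion, Finset.biUnion_image]
          rfl
      index := fun k => (hind k).imp fun o ho => ho.2.preimage hφ
      C_pos := fun k => one_pos.trans_le (hC₁ k)
      ε_pos := fun k => by positivity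
      tendsto_C := (tendsto_pow_atTop_atTop_of_one_lt one_lt_two).const_mul_atTop
        (one_pos.trans_le hB)
      tendsto_ε := (tendsto_pow_atTop_nhds_zero_of_lt_one (by norm_num) (by norm_num)).comp
        hn.tendsto_atTop
      summable_δ := summable_geometric_two
      norm_sum_le := fun k a F hF => hey k F hF a
      lt_norm_sum := fun k a s => hl k φ hφ.injective a s
      norm_le_δ := by
        intro k a ha ha₁
        have hpos : 0 < C (k + 2) := one_pos.trans_le (hC₁ _)
        have hnorm : ‖(((C (k + 2))⁻¹ : ℝ) : 𝕜)‖ = (C (k + 2))⁻¹ := by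
          rw [RCLike.norm_ofReal, abs_of_pos (inv_pos.2 hpos)]
        have := norm_le_of_starDelta_le (h𝓕 (n k)).isLowerSet
          (div_nonneg (by positivity) hpos.le) (hnΔ k) hφ.injective
          ((((C (k + 2))⁻¹ : ℝ) : 𝕜) • a) ?_ ?_
        · rw [map_smul, norm_smul, hnorm, div_eq_inv_mul] at this
          exact le_of_mul_le_mul_left this (inv_pos.2 hpos)
        · intro A hA
          simp only [Finsupp.smul_apply, smul_assoc]
          rw [← Finset.smul_sum, norm_smul, hnorm, ← one_div_pow]
          exact (mul_le_of_le_one_left (norm_nonneg _) (inv_le_one_of_one_le₀ (hC₁ _))).trans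
            (ha A (h𝓕𝓖 k hA))
        · rw [map_smul, norm_smul, hnorm]
          exact (inv_mul_le_one₀ hpos).2 ha₁ }
  exact P.exists_strictlySingular Q hQ hQ₁ hQ₀ ⟨2, hy⟩ fun θ v hθ =>
    hx.basic_right.not_tendsto hx₁ (hφ.comp hθ) v
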